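/- **Setting.** Fix integers $d,H,n\ge 1$ and $L\ge 2$, a real number $\gamma$ and a vector $v\in\mathbb R^H$. Consider bias-free fully connected ReLU networks with input dimension $d$ and hidden layers $1,\dots,L-1$ of width $H$, i.e. weight matrices $w_1\in\mathbb R^{d\times H}$ and $w_2,\dots,w_{L-1}\in\mathbb R^{H\times H}$, with $$o^0=x,\qquad o^l=\max(w_l^{T}o^{l-1},0)\ \ (1\le l\le L-1),\qquad f_w(x)=o^{L-1}\in\mathbb R^H .$$ Number the nodes of each layer from $0$. A *path* is a sequence $(i_0,i_1,\dots,i_{L-1})$ of nodes, one per layer, and its value is $p_{(i_0,\dots,i_{L-1})}=\prod_{l=1}^{L-1}w_l(i_{l-1},i_l)$. The *skeleton weights* are $w_1(j \bmod d,\,j)$ for $0\le j<H$ and the diagonal entries of $w_2,\dots,w_{L-1}$. The *negative basis paths* are the paths consisting of skeleton weights only; the *positive basis paths* are the paths with exactly one non-skeleton weight. The *basis-path norm* is $$\phi(p)=\sup\Big(\{|\log|p_i||: i \text{ a negative basis path}\}\cup\{|p_j|: j\text{ a positive basis path}\}\Big)\in[0,\infty],$$ with $|\log 0|=\infty$. Let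 $$\mathcal G^{d,H,L}_{\gamma,v}=\{x\mapsto v^{T}f_w(x)\;:\;\phi(p)\le\gamma\},$$ where $p$ is the vector of path values of $f_w$. Let $\ell:\mathbb R\times\{0,1\}\to[-1,1]$ be a loss function such that $\ell(\cdot,y)$ is $1$-Lipschitz for each $y\in\{0,1\}$. Let $\mathbb P$ be a probability measure on $\mathbb R^d\times\{0,1\}$, let $(x_1,y_1),\dots,(x_n,y_n)$ be i.i.d. with law $\mathbb P$, and let $$\epsilon_{gen}(\mathcal G)=\sup_{g\in\mathcal G}\Big|\frac1n\sum_{i=1}^n\ell(g(x_i),y_i)-\mathbb E_{(x,y)\sim\mathbb P}\,\ell(g(x),y)\Big| .$$ **Theorem.** For every $\delta>0$, with probability at least $1-\delta$, $$\epsilon_{gen}\big(\mathcal G^{d,H,L}_{\gamma,v}\big)\le 4\sqrt{\frac{2\ln(4/\delta)}{n}}+2\sqrt{\frac{2\,\Phi(\gamma;d,H,L)\,(4H)^{L-1}\,\|v\|_2^2\,\max_{1\le i\le n}\|x_i\|_2^2}{n}},$$ where $$\Phi(\gamma;d,H,L)=\big(He^{2\gamma}+(d-1)H\gamma^2\big)\big(1+(H-1)\gamma^2e^{2\gamma}\big)^{L-2}.$$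 (For $\delta>4$, where $\ln(4/\delta)<0$, the first square root is read as $0$.) -/

import Mathlib

open MeasureTheory
open scoped ENNReal

noncomputable section

/-- The weights of the feature map `f : ℝ^d → ℝ^H` of a depth-`L` fully connected network
(`L ≥ 2`, no biases) with input dimension `d` and hidden layers `1, …, L - 1` all of width `H`.
`first i j` is `w_1(i, j)` and `hidden l i j` is `w_{l+2}(i, j)` (`l = 0, …, L - 3`), where
`w_l(i, j)` is the weight of the edge from node `i` of layer `l - 1` to node `j` of layer `l`.
Layer `L` of the full network `v ∘ f` is the linear readout `v`, which is not part of `f`. -/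
structure ReLUNet (d H L : ℕ) where
  first : Matrix (Fin d) (Fin H) ℝ
  hidden : Fin (L - 2) → Matrix (Fin H) (Fin H) ℝ

/-- One fully connected ReLU layer, `o ↦ σ(wᵀ o)` with `σ = max(·, 0)` applied entrywise. -/
def reluLayer {a b : ℕ} (w : Matrix (Fin a) (Fin b) ℝ) (o : Fin a → ℝ) : Fin b → ℝ :=
  fun j => max (Matrix.mulVec w.transpose o j) 0

/-- Successive application of the ReLU layers with matrices `W 0, …, W (m - 1)`. -/
def reluLayers {H : ℕ} : (m : ℕ) → (Fin m → Matrix (Fin H) (Fin H) ℝ) →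
    (Fin H → ℝ) → (Fin H → ℝ)
  | 0, _, o => o
  | m + 1, W, o => reluLayer (W (Fin.last m)) (reluLayers m (fun l => W l.castSucc) o)

namespace ReLUNet

variable {d H L : ℕ}

/-- The network function `f : ℝ^d → ℝ^H`. -/
def eval (w : ReLUNet d H L) (x : EuclideanSpace ℝ (Fin d)) : Fin H → ℝ :=
  reluLayers (L - 2) w.hidden (reluLayer w.first (fun i => x i))

end ReLUNet

/-- A path through the network `f`: an input node `i_0` followed by one node in each of the
`L - 1 = (L - 2) + 1` layers of width `H`. -/
structure NetPath (d H L : ℕ) where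
  input : Fin d
  node : Fin (L - 2 + 1) → Fin H

namespace NetPath

variable {d H L : ℕ}

/-- The value of a path: the product of the weights along it. -/
def value (w : ReLUNet d H L) (q : NetPath d H L) : ℝ :=
  w.first q.input (q.node 0) * ∏ l : Fin (L - 2), w.hidden l (q.node l.castSucc) (q.node l.succ)

/-- The number of non-skeleton weights on a path. The skeleton weights are
`w_1(j mod d, j)` for every node `j` of the first hidden layer (nodes are numbered from `0`),
and the diagonal entries of all the later weight matrices. -/
def nonSkeletonCount (q : NetPath d H L) : ℕ :=
  (if (q.input : ℕ) = (q.node 0 : ℕ) % d then 0 else 1) +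
    (Finset.univ.filter fun l : Fin (L - 2) => q.node l.castSucc ≠ q.node l.succ).card

/-- Negative basis paths: those made of skeleton weights only. -/
def IsNegativeBasis (q : NetPath d H L) : Prop := q.nonSkeletonCount = 0

/-- Positive basis paths: those with exactly one non-skeleton weight. -/
def IsPositiveBasis (q : NetPath d H L) : Prop := q.nonSkeletonCount = 1

end NetPath

/-- The basis-path norm `φ(p)`: the supremum of `|log |p_i||` over the negative basis paths and
of `|p_j|` over the positive basis paths. It takes values in `[0, ∞]`: `ENNReal.log 0 = -∞`, so
that a vanishing negative basis path gives the value `∞`. -/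
def basisPathNorm {d H L : ℕ} (w : ReLUNet d H L) : ℝ≥0∞ :=
  max
    (⨆ (q : NetPath d H L) (_ : q.IsNegativeBasis), (ENNReal.log ‖q.value w‖ₑ).abs)
    (⨆ (q : NetPath d H L) (_ : q.IsPositiveBasis), ‖q.value w‖ₑ)

/-- The hypothesis space `{v ∘ f : φ(p) ≤ γ}`, for a fixed readout vector `v`. -/
def hypothesisSpace (d H L : ℕ) (γ : ℝ) (v : EuclideanSpace ℝ (Fin H)) :
    Set (EuclideanSpace ℝ (Fin d) → ℝ) :=
  {g | ∃ w : ReLUNet d H L, ((basisPathNorm w : ℝ≥0∞) : EReal) ≤ (γ : EReal) ∧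
    g = fun x => ∑ k, v k * w.eval x k}

/-- The uniform generalization error of a class `F` of real-valued functions for the loss `ℓ`,
the data distribution `P` and the sample `S`: the supremum over `g ∈ F` of
`|(1/n) ∑ ℓ(g(x_i), y_i) - E ℓ(g(x), y)|`, as an element of `[0, ∞]`. -/
def genError {X : Type*} [MeasurableSpace X] {n : ℕ} (F : Set (X → ℝ)) (ℓ : ℝ → Fin 2 → ℝ)
    (P : Measure (X × Fin 2)) (S : Fin n → X × Fin 2) : ℝ≥0∞ :=
  ⨆ g ∈ F, ENNReal.ofReal
    |(1 / (n : ℝ)) * ∑ i, ℓ (g (S i).1) (S i).2 - ∫ z, ℓ (g z.1) z.2 ∂P|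

/-- The basis-path measure `Φ(γ; d, H, L)`. -/
def basisPathMeasure (γ : ℝ) (d H L : ℕ) : ℝ :=
  ((H : ℝ) * Real.exp (2 * γ) + ((d : ℝ) - 1) * H * γ ^ 2) *
    (1 + ((H : ℝ) - 1) * γ ^ 2 * Real.exp (2 * γ)) ^ (L - 2)

end

/-!
Why the theorem holds. Two facts about the networks are combined with the standard passage from
Rademacher complexity to generalization error.

*Normalization.* Since the ReLU is positively homogeneous, the diagonal weights of all matrices
after the first can be rescaled to modulus one without changing the network function. After that,
a first-layer weight `(i, j)` is, up to sign, the value of the basis path which enters at `i` and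
stays at `j`, and an off-diagonal hidden weight is a quotient of a positive basis path by a negative
one. So `φ(p) ≤ γ` gives weight vectors of norm at most `√(e^{2γ} + (d - 1) γ²)` into the nodes of
the first layer and `√(1 + (H - 1) γ² e^{2γ})` into those of the later layers
(`norm_normalize_first_le`, `norm_normalize_hidden_le`); the product of the squares over the layers,
times `H`, is `Φ`.

*Peeling.* Layer by layer, the Rademacher complexity of the vector of outputs grows by a factor
of at most `2 √H ρ`, where `ρ` bounds the norms of the incoming weight vectors
(`sum_norm_rademacherSum_reluLayer_le`): `√H` for passing to the worst node, `2` for removing an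
absolute value, then the contraction principle removes the ReLU and Cauchy-Schwarz the weights.
At the input, orthogonality of the signs gives `√n max ‖x_i‖`. In these steps suprema over the
class, averaged over the signs, are expressed by choice functions from sign vectors to the class, so that
no boundedness is needed.

*Generalization.* For a countable class of functions with values in `[-1, 1]`, the uniform deviation
minus twice the empirical Rademacher complexity has nonpositive mean by symmetrization
(`integral_uniformDeviation_le`), and changes by at most `6 / n` with one point of the sample, hence
concentrates by McDiarmid's inequality (`hasSubgaussianMGF_of_bounded_differences`). This is applied
to `ℓ` and `-ℓ` with a countable dense set of weights; continuity of empirical and true risk in the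
weights extends the bound to the whole class.
-/

/-! ### Rademacher sums, contraction and peeling -/

/-- The signed sum `∑ i, σ i • y i` for a vector `σ` of signs. Averages over all
`σ : Fin n → ℤˣ` play the role of expectations over Rademacher variables. -/
noncomputable def rademacherSum {n : ℕ} {E : Type*} [AddCommMonoid E] [Module ℝ E]
    (σ : Fin n → ℤˣ) (y : Fin n → E) : E :=
  ∑ i, ((σ i : ℤ) : ℝ) • y i

theorem rademacherSum_neg {n : ℕ} {E : Type*} [AddCommGroup E] [Module ℝ E]
    (σ : Fin n → ℤˣ) (y : Fin n → E) : rademacherSum (-σ) y = -rademacherSum σ y := by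
  simp [rademacherSum]

theorem rademacherSum_apply {n a : ℕ} (σ : Fin n → ℤˣ) (y : Fin n → Fin a → ℝ) (j : Fin a) :
    rademacherSum σ y j = rademacherSum σ (fun i => y i j) := by
  simp [rademacherSum]

theorem dotProduct_rademacherSum {n a : ℕ} (σ : Fin n → ℤˣ) (u : Fin a → ℝ)
    (y : Fin n → Fin a → ℝ) :
    u ⬝ᵥ rademacherSum σ y = rademacherSum σ (fun i => u ⬝ᵥ y i) := by
  simp [rademacherSum, dotProduct_sum]

theorem abs_units_int (u : ℤˣ) : |((u : ℤ) : ℝ)| = 1 := by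
  rcases Int.units_eq_one_or u with rfl | rfl <;> simp

/-- One step of the contraction principle: in the `k`-th summand, `φ` is replaced by a function
`t` with larger increments. Sign vectors are paired by flipping the `k`-th sign; within a pair,
the choice function is either kept or exchanged. -/
theorem exists_sum_rademacherSum_le_of_eq_off {n : ℕ} {W : Type*} (k : Fin n)
    (φ t : Fin n → W → ℝ) (hne : ∀ i, i ≠ k → t i = φ i)
    (hk : ∀ a b, |φ k a - φ k b| ≤ |t k a - t k b|) (c : (Fin n → ℤˣ) → W) :
    ∃ c' : (Fin n → ℤˣ) → W,
      ∑ σ, rademacherSum σ (fun i => φ i (c σ)) ≤ ∑ σ, rademacherSum σ (fun i => t i (c' σ)) := by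
  classical
  set fl : (Fin n → ℤˣ) → (Fin n → ℤˣ) := fun σ => Function.update σ k (-σ k) with hfl
  have hinv : Function.Involutive fl := by
    intro σ; simp [hfl]
  let A : (Fin n → ℤˣ) → W → ℝ := fun σ w => ∑ i ∈ Finset.univ.erase k, ((σ i : ℤ) : ℝ) * φ i w
  have hA : ∀ σ w, A (fl σ) w = A σ w := by
    intro σ w
    refine Finset.sum_congr rfl fun i hi => ?_
    simp [hfl, Function.update_of_ne (Finset.ne_of_mem_erase hi)]
  have hF : ∀ σ w, rademacherSum σ (fun i => φ i w) = ((σ k : ℤ) : ℝ) * φ k w + A σ w := by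
    intro σ w
    simp only [rademacherSum, smul_eq_mul, A]
    rw [Finset.add_sum_erase _ (fun i => ((σ i : ℤ) : ℝ) * φ i w) (Finset.mem_univ k)]
  have hG : ∀ σ w, rademacherSum σ (fun i => t i w) = ((σ k : ℤ) : ℝ) * t k w + A σ w := by
    intro σ w
    simp only [rademacherSum, smul_eq_mul, A]
    rw [← Finset.add_sum_erase _ (fun i => ((σ i : ℤ) : ℝ) * t i w) (Finset.mem_univ k)]
    congr 1
    refine Finset.sum_congr rfl fun i hi => ?_
    rw [hne i (Finset.ne_of_mem_erase hi)]
  have hflk : ∀ σ, (((fl σ) k : ℤ) : ℝ) = -((σ k : ℤ) : ℝ) := by intro σ; simp [hfl]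
  let Q : (Fin n → ℤˣ) → Prop := fun σ =>
    ((σ k : ℤ) : ℝ) * (φ k (c σ) - φ k (c (fl σ))) ≤ ((σ k : ℤ) : ℝ) * (t k (c σ) - t k (c (fl σ)))
  have hQ : ∀ σ, Q (fl σ) ↔ Q σ := by
    intro σ
    simp only [Q, hflk, hinv σ]
    constructor <;> intro h <;> linarith
  refine ⟨fun σ => if Q σ then c σ else c (fl σ), ?_⟩
  set c' : (Fin n → ℤˣ) → W := fun σ => if Q σ then c σ else c (fl σ) with hc'
  have key : ∀ σ, rademacherSum σ (fun i => φ i (c σ)) +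
      rademacherSum (fl σ) (fun i => φ i (c (fl σ))) ≤
      rademacherSum σ (fun i => t i (c' σ)) + rademacherSum (fl σ) (fun i => t i (c' (fl σ))) := by
    intro σ
    rw [hF, hF, hG, hG, hflk, hA, hA]
    by_cases h : Q σ
    · have h' := (hQ σ).2 h
      simp only [hc', if_pos h, if_pos h']
      simp only [Q] at h
      linarith
    · have h' : ¬ Q (fl σ) := fun h' => h ((hQ σ).1 h')
      simp only [hc', if_neg h, if_neg h', hinv σ]
      simp only [Q, not_le] at h
      have h1 := hk (c σ) (c (fl σ))
      rcases Int.units_eq_one_or (σ k) with hs | hs <;> simp only [hs] at h ⊢ <;>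
        push_cast [Units.val_neg] at h ⊢ <;>
        rcases abs_cases (φ k (c σ) - φ k (c (fl σ))) with h2 | h2 <;>
        rcases abs_cases (t k (c σ) - t k (c (fl σ))) with h3 | h3 <;> linarith
  have hsum : ∀ f : (Fin n → ℤˣ) → ℝ, ∑ σ, f (fl σ) = ∑ σ, f σ := fun f =>
    Equiv.sum_comp hinv.toPerm f
  have := Finset.sum_le_sum fun σ (_ : σ ∈ Finset.univ) => key σ
  rw [Finset.sum_add_distrib, Finset.sum_add_distrib,
    hsum (fun σ => rademacherSum σ (fun i => φ i (c σ))),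
    hsum (fun σ => rademacherSum σ (fun i => t i (c' σ)))] at this
  linarith

/-- **Contraction principle** of Ledoux and Talagrand, for choice functions instead of suprema:
the average of a supremum over `W` is the supremum of the averages over all functions `c` from
sign vectors to `W`, and in this form no boundedness is needed. -/
theorem exists_sum_rademacherSum_le {n : ℕ} {W : Type*} (φ t : Fin n → W → ℝ)
    (h : ∀ i a b, |φ i a - φ i b| ≤ |t i a - t i b|) (c : (Fin n → ℤˣ) → W) :
    ∃ c' : (Fin n → ℤˣ) → W,
      ∑ σ, rademacherSum σ (fun i => φ i (c σ)) ≤ ∑ σ, rademacherSum σ (fun i => t i (c' σ)) := by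
  classical
  suffices H : ∀ s : Finset (Fin n), ∃ c' : (Fin n → ℤˣ) → W,
      ∑ σ, rademacherSum σ (fun i => φ i (c σ)) ≤
        ∑ σ, rademacherSum σ (fun i => (if i ∈ s then t i else φ i) (c' σ)) by
    simpa using H Finset.univ
  intro s
  induction s using Finset.induction_on with
  | empty => exact ⟨c, by simp⟩
  | insert k s hks ih =>
    obtain ⟨c₁, hc₁⟩ := ih
    obtain ⟨c₂, hc₂⟩ := exists_sum_rademacherSum_le_of_eq_off k
      (fun i => if i ∈ s then t i else φ i) (fun i => if i ∈ insert k s then t i else φ i)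
      (by intro i hi; simp [hi]) (by intro a b; simpa [hks] using h k a b) c₁
    exact ⟨c₂, hc₁.trans hc₂⟩

/-- Absolute values cost a factor `2` when the class contains an element at which the process
vanishes: positive and negative parts are bounded separately, the latter after `σ ↦ -σ`. -/
theorem sum_abs_le_two_mul {n : ℕ} {V : Type*} (a : (Fin n → ℤˣ) → V → ℝ)
    (hneg : ∀ σ v, a (-σ) v = -a σ v) (v₀ : V) (h₀ : ∀ σ, a σ v₀ = 0) (K : ℝ)
    (hK : ∀ c : (Fin n → ℤˣ) → V, ∑ σ, a σ (c σ) ≤ K) (c : (Fin n → ℤˣ) → V) :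
    ∑ σ, |a σ (c σ)| ≤ 2 * K := by
  classical
  have h1 := hK (fun σ => if 0 ≤ a σ (c σ) then c σ else v₀)
  have h2 := hK (fun σ => if a (-σ) (c (-σ)) ≤ 0 then c (-σ) else v₀)
  rw [← Equiv.sum_comp (Equiv.neg (Fin n → ℤˣ))] at h2
  have h3 : ∑ σ, |a σ (c σ)| ≤ ∑ σ, (a σ (if 0 ≤ a σ (c σ) then c σ else v₀) +
      a (-σ) (if a σ (c σ) ≤ 0 then c σ else v₀)) := by
    refine Finset.sum_le_sum fun σ _ => ?_
    rw [hneg]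
    split_ifs with h h' h'
    · have : a σ (c σ) = 0 := le_antisymm h' h
      simp [this]
    · simp [h₀, abs_of_nonneg h]
    · simp [h₀, abs_of_nonpos h']
    · linarith
  rw [Finset.sum_add_distrib] at h3
  simp only [Equiv.neg_apply, neg_neg] at h2
  linarith

theorem abs_dotProduct_le_norm_mul_norm {a : ℕ} (u z : Fin a → ℝ) :
    |u ⬝ᵥ z| ≤ ‖WithLp.toLp 2 u‖ * ‖WithLp.toLp 2 z‖ := by
  have := abs_real_inner_le_norm (WithLp.toLp 2 z) (WithLp.toLp 2 u)
  rw [EuclideanSpace.inner_toLp_toLp] at this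
  simpa [mul_comm] using this

theorem exists_norm_toLp_le_sqrt_mul_abs {b : ℕ} [NeZero b] (z : Fin b → ℝ) :
    ∃ j, ‖WithLp.toLp 2 z‖ ≤ √b * |z j| := by
  obtain ⟨j, hj⟩ := Finite.exists_max (fun j => |z j|)
  refine ⟨j, ?_⟩
  rw [EuclideanSpace.norm_eq, ← Real.sqrt_sq (abs_nonneg (z j)),
    ← Real.sqrt_mul (Nat.cast_nonneg b)]
  refine Real.sqrt_le_sqrt ?_
  calc ∑ i, ‖z i‖ ^ 2 ≤ ∑ _i : Fin b, |z j| ^ 2 := by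
        gcongr with i; exact hj i
    _ = b * |z j| ^ 2 := by simp

/-- Peeling off one layer: a ReLU layer whose incoming weight vectors have norm at most `ρ`
multiplies the (unnormalized) Rademacher complexity of its input by at most `2 √b ρ`, where `b`
is its width. -/
theorem sum_norm_rademacherSum_reluLayer_le {W : Type*} {n a b : ℕ} [NeZero b]
    (o : W → Fin n → Fin a → ℝ) {B : ℝ}
    (hB : ∀ c : (Fin n → ℤˣ) → W, ∑ σ, ‖WithLp.toLp 2 (rademacherSum σ (o (c σ)))‖ ≤ B)
    {ρ : ℝ} (hρ : 0 ≤ ρ) (c : (Fin n → ℤˣ) → W) (M : (Fin n → ℤˣ) → Matrix (Fin a) (Fin b) ℝ)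
    (hM : ∀ σ j, ‖WithLp.toLp 2 (fun i => M σ i j)‖ ≤ ρ) :
    ∑ σ, ‖WithLp.toLp 2 (rademacherSum σ (fun i => reluLayer (M σ) (o (c σ) i)))‖ ≤
      2 * √b * ρ * B := by
  choose j hj using fun σ =>
    exists_norm_toLp_le_sqrt_mul_abs (rademacherSum σ (fun i => reluLayer (M σ) (o (c σ) i)))
  let V := W × {u : Fin a → ℝ // ‖WithLp.toLp 2 u‖ ≤ ρ}
  have habs := sum_abs_le_two_mul (V := V)
    (fun σ v => rademacherSum σ (fun i => max (v.2.1 ⬝ᵥ o v.1 i) 0))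
    (fun σ v => rademacherSum_neg σ _) (c 1, ⟨0, by simpa using hρ⟩)
    (by intro σ; simp [rademacherSum]) (ρ * B) (by
      intro c₁
      obtain ⟨c₂, hc₂⟩ := exists_sum_rademacherSum_le (W := V)
        (fun i v => max (v.2.1 ⬝ᵥ o v.1 i) 0) (fun i v => v.2.1 ⬝ᵥ o v.1 i)
        (fun i x y => abs_max_sub_max_le_abs _ _ _) c₁
      refine hc₂.trans ?_
      calc ∑ σ, rademacherSum σ (fun i => (c₂ σ).2.1 ⬝ᵥ o (c₂ σ).1 i)
          ≤ ∑ σ, ρ * ‖WithLp.toLp 2 (rademacherSum σ (o (c₂ σ).1))‖ := by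
            refine Finset.sum_le_sum fun σ _ => ?_
            rw [← dotProduct_rademacherSum]
            refine (le_abs_self _).trans ((abs_dotProduct_le_norm_mul_norm _ _).trans ?_)
            gcongr
            exact (c₂ σ).2.2
        _ ≤ ρ * B := by
            rw [← Finset.mul_sum]
            gcongr
            exact hB fun σ => (c₂ σ).1)
    (fun σ => (c σ, ⟨fun i => M σ i (j σ), hM σ (j σ)⟩))
  calc _ ≤ ∑ σ, √b * |rademacherSum σ (fun i => reluLayer (M σ) (o (c σ) i)) (j σ)| :=
        Finset.sum_le_sum fun σ _ => hj σ
    _ = √b * ∑ σ, |rademacherSum σ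
          (fun i => max ((fun i => M σ i (j σ)) ⬝ᵥ o (c σ) i) 0)| := by
        rw [Finset.mul_sum]
        refine Finset.sum_congr rfl fun σ _ => ?_
        rw [rademacherSum_apply]
        rfl
    _ ≤ √b * (2 * (ρ * B)) := by gcongr
    _ = 2 * √b * ρ * B := by ring

/-- Peeling off all the hidden layers after the first. -/
theorem sum_norm_rademacherSum_reluLayers_le {W : Type*} {n H : ℕ} [NeZero H]
    (o : W → Fin n → Fin H → ℝ) {B : ℝ}
    (hB : ∀ c : (Fin n → ℤˣ) → W, ∑ σ, ‖WithLp.toLp 2 (rademacherSum σ (o (c σ)))‖ ≤ B)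
    {ρ : ℝ} (hρ : 0 ≤ ρ) (m : ℕ) (c : (Fin n → ℤˣ) → W)
    (M : (Fin n → ℤˣ) → Fin m → Matrix (Fin H) (Fin H) ℝ)
    (hM : ∀ σ l j, ‖WithLp.toLp 2 (fun i => M σ l i j)‖ ≤ ρ) :
    ∑ σ, ‖WithLp.toLp 2 (rademacherSum σ (fun i => reluLayers m (M σ) (o (c σ) i)))‖ ≤
      (2 * √H * ρ) ^ m * B := by
  induction m generalizing c with
  | zero => simpa [reluLayers] using hB c
  | succ m ih =>
    -- The first `m` layers are indexed by all admissible weights, not only by those chosen by `M`.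
    have := sum_norm_rademacherSum_reluLayer_le (n := n) (b := H)
      (W := W × {N : Fin m → Matrix (Fin H) (Fin H) ℝ //
        ∀ l j, ‖WithLp.toLp 2 (fun i => N l i j)‖ ≤ ρ})
      (fun w i => reluLayers m w.2.1 (o w.1 i)) (B := (2 * √H * ρ) ^ m * B)
      (fun c' => ih (fun σ => (c' σ).1) (fun σ => (c' σ).2.1) (fun σ => (c' σ).2.2)) hρ
      (fun σ => (c σ, ⟨fun l => M σ l.castSucc, fun l => hM σ _⟩))
      (fun σ => M σ (Fin.last m)) (fun σ => hM σ _)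
    rw [pow_succ', mul_assoc]
    exact this

theorem card_signs (n : ℕ) : (Finset.univ : Finset (Fin n → ℤˣ)).card = 2 ^ n := by
  simp

theorem sum_sign_mul_sign {n : ℕ} (i j : Fin n) :
    ∑ σ : Fin n → ℤˣ, ((σ i : ℤ) : ℝ) * ((σ j : ℤ) : ℝ) = if i = j then 2 ^ n else 0 := by
  classical
  split_ifs with h
  · subst h
    have : ∀ σ : Fin n → ℤˣ, ((σ i : ℤ) : ℝ) * ((σ i : ℤ) : ℝ) = 1 := by
      intro σ
      rcases Int.units_eq_one_or (σ i) with hs | hs <;> simp [hs]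
    simp [this]
  · -- Flipping the `i`-th sign changes the sign of every summand.
    set fl : (Fin n → ℤˣ) → (Fin n → ℤˣ) := fun σ => Function.update σ i (-σ i) with hfl
    have hinv : Function.Involutive fl := by
      intro σ; simp [hfl]
    have h1 : ∀ g : (Fin n → ℤˣ) → ℝ, ∑ σ, g (fl σ) = ∑ σ, g σ := fun g =>
      Equiv.sum_comp hinv.toPerm g
    have h2 : ∀ σ : Fin n → ℤˣ, ((fl σ i : ℤ) : ℝ) * ((fl σ j : ℤ) : ℝ) =
        -(((σ i : ℤ) : ℝ) * ((σ j : ℤ) : ℝ)) := by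
      intro σ
      simp [hfl, Function.update_of_ne (Ne.symm h)]
    replace h1 := h1 fun σ => ((σ i : ℤ) : ℝ) * ((σ j : ℤ) : ℝ)
    simp only [h2, Finset.sum_neg_distrib] at h1
    linarith

theorem sum_rademacherSum_sq {n : ℕ} (t : Fin n → ℝ) :
    ∑ σ, rademacherSum σ t ^ 2 = 2 ^ n * ∑ i, t i ^ 2 := by
  calc ∑ σ, rademacherSum σ t ^ 2
      = ∑ σ : Fin n → ℤˣ, ∑ i, ∑ j, t i * t j * (((σ i : ℤ) : ℝ) * ((σ j : ℤ) : ℝ)) := by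
        refine Finset.sum_congr rfl fun σ _ => ?_
        rw [rademacherSum, sq, Finset.sum_mul_sum]
        refine Finset.sum_congr rfl fun i _ => Finset.sum_congr rfl fun j _ => ?_
        simp only [smul_eq_mul]
        ring
    _ = ∑ i, ∑ j, t i * t j * ∑ σ : Fin n → ℤˣ, ((σ i : ℤ) : ℝ) * ((σ j : ℤ) : ℝ) := by
        rw [Finset.sum_comm]
        refine Finset.sum_congr rfl fun i _ => ?_
        rw [Finset.sum_comm]
        simp only [Finset.mul_sum]
    _ = 2 ^ n * ∑ i, t i ^ 2 := by
        simp only [sum_sign_mul_sign, mul_ite, mul_zero, Finset.sum_ite_eq, Finset.mem_univ,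
          if_true, Finset.mul_sum]
        exact Finset.sum_congr rfl fun i _ => by ring

/-- The Rademacher complexity of a single point, from orthogonality of the signs. -/
theorem sum_norm_rademacherSum_le {n a : ℕ} (y : Fin n → Fin a → ℝ) {r : ℝ} (hr : 0 ≤ r)
    (hy : ∀ i, ‖WithLp.toLp 2 (y i)‖ ≤ r) :
    ∑ σ, ‖WithLp.toLp 2 (rademacherSum σ y)‖ ≤ 2 ^ n * (√n * r) := by
  have hsq : ∑ σ, ‖WithLp.toLp 2 (rademacherSum σ y)‖ ^ 2 =
      2 ^ n * ∑ i, ‖WithLp.toLp 2 (y i)‖ ^ 2 := by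
    simp only [EuclideanSpace.real_norm_sq_eq, rademacherSum_apply]
    rw [Finset.sum_comm, Finset.sum_comm (s := (Finset.univ : Finset (Fin n))), Finset.mul_sum]
    exact Finset.sum_congr rfl fun j _ => sum_rademacherSum_sq fun i => y i j
  have hcs := Finset.sum_mul_sq_le_sq_mul_sq (Finset.univ : Finset (Fin n → ℤˣ)) (fun _ => (1 : ℝ))
    (fun σ => ‖WithLp.toLp 2 (rademacherSum σ y)‖)
  refine abs_le_of_sq_le_sq' (b := 2 ^ n * (√n * r)) ?_ (by positivity) |>.2
  simp only [one_mul] at hcs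
  refine hcs.trans ?_
  rw [hsq]
  have : ∑ i, ‖WithLp.toLp 2 (y i)‖ ^ 2 ≤ n * r ^ 2 := by
    calc _ ≤ ∑ _i : Fin n, r ^ 2 := by gcongr with i; exact hy i
      _ = _ := by simp
  simp only [one_pow, Finset.sum_const, card_signs, nsmul_eq_mul, mul_one, mul_pow,
    Real.sq_sqrt (Nat.cast_nonneg n)]
  push_cast
  calc _ ≤ (2:ℝ) ^ n * (2 ^ n * (n * r ^ 2)) := by gcongr
    _ = _ := by ring

/-! ### Basis paths and normalized weights -/

theorem nonneg_of_basisPathNorm_le {d H L : ℕ} {w : ReLUNet d H L} {γ : ℝ}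
    (h : ((basisPathNorm w : ℝ≥0∞) : EReal) ≤ (γ : EReal)) : 0 ≤ γ := by
  have := (EReal.coe_ennreal_nonneg (basisPathNorm w)).trans h
  exact_mod_cast this

theorem basisPathNorm_le_ofReal {d H L : ℕ} {w : ReLUNet d H L} {γ : ℝ}
    (h : ((basisPathNorm w : ℝ≥0∞) : EReal) ≤ (γ : EReal)) :
    basisPathNorm w ≤ ENNReal.ofReal γ := by
  rw [← EReal.coe_ennreal_le_coe_ennreal_iff, EReal.coe_ennreal_ofReal,
    max_eq_left (nonneg_of_basisPathNorm_le h)]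
  exact h

theorem abs_value_le_of_isPositiveBasis {d H L : ℕ} {w : ReLUNet d H L} {γ : ℝ}
    (h : ((basisPathNorm w : ℝ≥0∞) : EReal) ≤ (γ : EReal)) {q : NetPath d H L}
    (hq : q.IsPositiveBasis) : |q.value w| ≤ γ := by
  have h1 : ‖q.value w‖ₑ ≤ ENNReal.ofReal γ :=
    (le_iSup₂ (f := fun (q : NetPath d H L) (_ : q.IsPositiveBasis) => ‖q.value w‖ₑ) q hq).trans
      ((le_max_right _ _).trans (basisPathNorm_le_ofReal h))
  rwa [← ofReal_norm, ENNReal.ofReal_le_ofReal_iff (nonneg_of_basisPathNorm_le h)] at h1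

theorem abs_value_mem_Icc_of_isNegativeBasis {d H L : ℕ} {w : ReLUNet d H L} {γ : ℝ}
    (h : ((basisPathNorm w : ℝ≥0∞) : EReal) ≤ (γ : EReal)) {q : NetPath d H L}
    (hq : q.IsNegativeBasis) : |q.value w| ∈ Set.Icc (Real.exp (-γ)) (Real.exp γ) := by
  have h1 : (ENNReal.log ‖q.value w‖ₑ).abs ≤ ENNReal.ofReal γ :=
    (le_iSup₂ (f := fun (q : NetPath d H L) (_ : q.IsNegativeBasis) =>
      (ENNReal.log ‖q.value w‖ₑ).abs) q hq).trans
      ((le_max_left _ _).trans (basisPathNorm_le_ofReal h))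
  by_cases h0 : q.value w = 0
  · rw [h0] at h1
    simp at h1
  have hpos : 0 < |q.value w| := abs_pos.2 h0
  rw [← ofReal_norm, Real.norm_eq_abs, ENNReal.log_ofReal_of_pos hpos, EReal.abs_def,
    ENNReal.ofReal_le_ofReal_iff (nonneg_of_basisPathNorm_le h), abs_le] at h1
  rw [Set.mem_Icc, ← Real.le_log_iff_exp_le hpos, ← Real.log_le_iff_le_exp hpos]
  exact h1

theorem norm_toLp_le_of_abs_le {a : ℕ} (f : Fin a → ℝ) (i₀ : Fin a) {A C : ℝ}
    (h₀ : |f i₀| ≤ A) (h : ∀ i, i ≠ i₀ → |f i| ≤ C) :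
    ‖WithLp.toLp 2 f‖ ≤ √(A ^ 2 + ((a : ℝ) - 1) * C ^ 2) := by
  classical
  rw [EuclideanSpace.norm_eq]
  refine Real.sqrt_le_sqrt ?_
  have hsq : ∀ {x y : ℝ}, |x| ≤ y → ‖x‖ ^ 2 ≤ y ^ 2 := fun hx =>
    pow_le_pow_left₀ (norm_nonneg _) hx 2
  rw [← Finset.add_sum_erase _ _ (Finset.mem_univ i₀)]
  refine add_le_add (hsq h₀) ?_
  calc _ ≤ ∑ i ∈ Finset.univ.erase i₀, C ^ 2 :=
        Finset.sum_le_sum fun i hi => hsq (h i (Finset.ne_of_mem_erase hi))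
    _ = _ := by
        have : 1 ≤ a := i₀.pos
        rw [Finset.sum_const, Finset.card_erase_of_mem (Finset.mem_univ _), Finset.card_fin,
          nsmul_eq_mul, Nat.cast_sub this, Nat.cast_one]

/-- Positive homogeneity of the ReLU: multiplying the incoming weights of a node by a positive
number and dividing the outgoing ones by it changes nothing downstream. -/
theorem reluLayers_rescale {H : ℕ} (m : ℕ) (W : Fin m → Matrix (Fin H) (Fin H) ℝ)
    (D : ℕ → Fin H → ℝ) (hD : ∀ l j, 0 < D l j) (o : Fin H → ℝ) :
    reluLayers m (fun l => Matrix.of fun j k => W l j k * D (l + 1) k / D l j)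
      (fun j => D 0 j * o j) = fun k => D m k * reluLayers m W o k := by
  induction m with
  | zero => rfl
  | succ m ih =>
    have ih' := ih fun l => W l.castSucc
    funext k
    simp only [reluLayers, reluLayer, Fin.val_last, Fin.val_castSucc] at ih' ⊢
    rw [ih', mul_max_of_nonneg _ _ (hD _ _).le, mul_zero]
    congr 1
    simp only [Matrix.mulVec, dotProduct, Matrix.transpose_apply, Matrix.of_apply, Finset.mul_sum]
    refine Finset.sum_congr rfl fun j _ => ?_
    have := (hD m j).ne'
    field_simp

theorem reluLayer_rescale {a b : ℕ} (w : Matrix (Fin a) (Fin b) ℝ) (D : Fin b → ℝ)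
    (hD : ∀ j, 0 < D j) (o : Fin a → ℝ) :
    reluLayer (Matrix.of fun i j => w i j * D j) o = fun j => D j * reluLayer w o j := by
  funext j
  simp only [reluLayer]
  rw [mul_max_of_nonneg _ _ (hD _).le, mul_zero]
  congr 1
  simp only [Matrix.mulVec, dotProduct, Matrix.transpose_apply, Matrix.of_apply, Finset.mul_sum]
  exact Finset.sum_congr rfl fun i _ => by ring

namespace ReLUNet

variable {d H L : ℕ}

/-- `w.tail l j` is the product of the moduli of the diagonal weights at `j` of the matrices
`hidden l, hidden (l + 1), …`. -/
noncomputable def tail (w : ReLUNet d H L) (l : ℕ) (j : Fin H) : ℝ :=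
  ∏ m : Fin (L - 2), if l ≤ m then |w.hidden m j j| else 1

/-- The rescaling of `w` in which the diagonal weights of all matrices but the first have modulus
one. It computes the same function as `w` when none of those diagonal weights vanishes; otherwise
the division by `tail` has no meaning. -/
noncomputable def normalize (w : ReLUNet d H L) : ReLUNet d H L where
  first := Matrix.of fun i j => w.first i j * w.tail 0 j
  hidden l := Matrix.of fun j k => w.hidden l j k * w.tail (l + 1) k / w.tail l j

theorem tail_last (w : ReLUNet d H L) (j : Fin H) : w.tail (L - 2) j = 1 :=
  Finset.prod_eq_one fun m _ => if_neg (by omega)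

theorem eval_normalize (w : ReLUNet d H L) (hw : ∀ l j, 0 < w.tail l j)
    (x : EuclideanSpace ℝ (Fin d)) : w.normalize.eval x = w.eval x := by
  simp only [eval, normalize]
  rw [reluLayer_rescale w.first (w.tail 0) (hw 0), reluLayers_rescale _ _ w.tail hw]
  simp [tail_last]

end ReLUNet

namespace NetPath

variable {d H L : ℕ}

/-- The path that enters at `i` and then stays at node `j` of every layer. -/
def const (i : Fin d) (j : Fin H) : NetPath d H L := ⟨i, fun _ => j⟩

/-- The path that enters at `i`, stays at node `j` and moves to node `k` in the matrix
`hidden l`. -/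
def jump (i : Fin d) (j k : Fin H) (l : Fin (L - 2)) : NetPath d H L :=
  ⟨i, fun m => if (m : ℕ) ≤ l then j else k⟩

theorem abs_value_const (w : ReLUNet d H L) (i : Fin d) (j : Fin H) :
    |(const i j : NetPath d H L).value w| = |w.normalize.first i j| := by
  have : 0 ≤ w.tail 0 j := Finset.prod_nonneg fun m _ => by positivity
  simp [value, const, ReLUNet.normalize, ReLUNet.tail, abs_mul, Finset.abs_prod]

theorem nonSkeletonCount_const (i : Fin d) (j : Fin H) :
    (const i j : NetPath d H L).nonSkeletonCount = if (i : ℕ) = (j : ℕ) % d then 0 else 1 := by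
  simp only [nonSkeletonCount, const, ne_eq, not_true_eq_false, Finset.filter_false,
    Finset.card_empty, add_zero]
  rfl

theorem nonSkeletonCount_jump {i : Fin d} {j k : Fin H} (hi : (i : ℕ) = (j : ℕ) % d)
    (hjk : j ≠ k) (l : Fin (L - 2)) : (jump i j k l).nonSkeletonCount = 1 := by
  have : (Finset.univ.filter fun m : Fin (L - 2) =>
      (jump i j k l).node m.castSucc ≠ (jump i j k l).node m.succ) = {l} := by
    ext m
    rw [Finset.mem_filter, Finset.mem_singleton, Fin.ext_iff]
    simp only [jump, Finset.mem_univ, true_and, Fin.val_castSucc, Fin.val_succ]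
    split_ifs <;> simp_all <;> omega
  rw [nonSkeletonCount, this]
  simp [jump, hi]

theorem abs_value_jump (w : ReLUNet d H L) (hw : ∀ l j, 0 < w.tail l j) (i : Fin d)
    (j k : Fin H) (l : Fin (L - 2)) :
    |(jump i j k l).value w| = |w.normalize.first i j| * |w.normalize.hidden l j k| := by
  have key : (∏ m : Fin (L - 2), |w.hidden m ((jump i j k l).node m.castSucc)
      ((jump i j k l).node m.succ)|) * w.tail l j =
      w.tail 0 j * |w.hidden l j k| * w.tail (l + 1) k := by
    have hl : |w.hidden l j k| = ∏ m : Fin (L - 2), if m = l then |w.hidden l j k| else 1 := by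
      simp
    rw [hl, ReLUNet.tail, ReLUNet.tail, ReLUNet.tail, ← Finset.prod_mul_distrib,
      ← Finset.prod_mul_distrib, ← Finset.prod_mul_distrib]
    refine Finset.prod_congr rfl fun m _ => ?_
    simp only [jump, Fin.val_castSucc, Fin.val_succ]
    rcases lt_trichotomy m l with h | h | h
    · have h' : (m : ℕ) < l := h
      simp [h.ne, h'.le, h'.not_ge, show (m : ℕ) + 1 ≤ l from h',
        show ¬ ((l : ℕ) + 1 ≤ m) by omega]
    · subst h
      simp [mul_comm]
    · have h' : (l : ℕ) < m := h
      simp [h.ne', h'.le, h'.not_ge, show ¬ ((m : ℕ) + 1 ≤ l) by omega, mul_comm,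
        show ((l : ℕ) + 1 ≤ m) by omega]
  have h0 := hw 0 j
  have h1 := hw l j
  have h2 := hw (l + 1) k
  rw [value, abs_mul, Finset.abs_prod, eq_div_of_mul_eq h1.ne' key]
  simp only [ReLUNet.normalize, Matrix.of_apply, abs_mul, abs_div, abs_of_pos h0, abs_of_pos h1,
    abs_of_pos h2]
  simp only [jump, Fin.val_zero, zero_le, if_true]
  ring

end NetPath

namespace ReLUNet

variable {d H L : ℕ}

theorem tail_pos {w : ReLUNet d H L} {γ : ℝ} (hd : 1 ≤ d)
    (h : ((basisPathNorm w : ℝ≥0∞) : EReal) ≤ (γ : EReal)) (l : ℕ) (j : Fin H) :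
    0 < w.tail l j := by
  have hneg := abs_value_mem_Icc_of_isNegativeBasis h
    (q := NetPath.const ⟨(j : ℕ) % d, Nat.mod_lt _ hd⟩ j)
    (by simp [NetPath.IsNegativeBasis, NetPath.nonSkeletonCount_const])
  have hne := abs_pos.1 ((Real.exp_pos _).trans_le hneg.1)
  refine Finset.prod_pos fun m _ => ?_
  split_ifs
  · simp only [NetPath.value, NetPath.const] at hne
    exact abs_pos.2 (Finset.prod_ne_zero_iff.1 (right_ne_zero_of_mul hne) m (Finset.mem_univ m))
  · exact one_pos

/-- The incoming weight vector at `j` of the normalized first layer consists of the values of the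
basis paths that stay at `j`: one negative and `d - 1` positive ones. -/
theorem norm_normalize_first_le {w : ReLUNet d H L} {γ : ℝ} (hd : 1 ≤ d)
    (h : ((basisPathNorm w : ℝ≥0∞) : EReal) ≤ (γ : EReal)) (j : Fin H) :
    ‖WithLp.toLp 2 (fun i => w.normalize.first i j)‖ ≤
      √(Real.exp (2 * γ) + ((d : ℝ) - 1) * γ ^ 2) := by
  have := norm_toLp_le_of_abs_le (fun i => w.normalize.first i j)
    ⟨(j : ℕ) % d, Nat.mod_lt _ hd⟩ (A := Real.exp γ) (C := γ) (by
      rw [← NetPath.abs_value_const]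
      exact (abs_value_mem_Icc_of_isNegativeBasis h
        (by simp [NetPath.IsNegativeBasis, NetPath.nonSkeletonCount_const])).2) (by
      intro i hi
      rw [← NetPath.abs_value_const]
      refine abs_value_le_of_isPositiveBasis h ?_
      rw [NetPath.IsPositiveBasis, NetPath.nonSkeletonCount_const, if_neg]
      simpa [Fin.ext_iff] using hi)
  rwa [← Real.exp_nat_mul, Nat.cast_ofNat] at this

/-- An off-diagonal normalized weight is the quotient of a positive basis path by a negative
one. -/
theorem norm_normalize_hidden_le {w : ReLUNet d H L} {γ : ℝ} (hd : 1 ≤ d)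
    (h : ((basisPathNorm w : ℝ≥0∞) : EReal) ≤ (γ : EReal)) (l : Fin (L - 2)) (k : Fin H) :
    ‖WithLp.toLp 2 (fun j => w.normalize.hidden l j k)‖ ≤
      √(1 + ((H : ℝ) - 1) * γ ^ 2 * Real.exp (2 * γ)) := by
  have hpos := tail_pos hd h
  have := norm_toLp_le_of_abs_le (fun j => w.normalize.hidden l j k) k (A := 1)
    (C := γ * Real.exp γ) (by
      have hl : w.tail l k = |w.hidden l k k| * w.tail (l + 1) k := by
        have hl : |w.hidden l k k| = ∏ m : Fin (L - 2), if m = l then |w.hidden m k k| else 1 := by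
          simp
        rw [hl, tail, tail, ← Finset.prod_mul_distrib]
        refine Finset.prod_congr rfl fun m _ => ?_
        rcases lt_trichotomy m l with h | h | h
        · have h' : (m : ℕ) < l := h
          simp [h.ne, h'.not_ge, show ¬ ((l : ℕ) + 1 ≤ m) by omega]
        · subst h
          simp
        · have h' : (l : ℕ) < m := h
          simp [h.ne', h'.le, show ((l : ℕ) + 1 ≤ m) by omega]
      simp only [normalize, Matrix.of_apply, abs_div, abs_mul, abs_of_pos (hpos l k),
        abs_of_pos (hpos (l + 1) k), ← hl]
      exact (div_self (hpos l k).ne').le) (by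
      intro j hj
      set i : Fin d := ⟨(j : ℕ) % d, Nat.mod_lt _ hd⟩ with hi
      have h1 := abs_value_le_of_isPositiveBasis h
        (NetPath.nonSkeletonCount_jump (i := i) (by simp [hi]) hj l)
      rw [NetPath.abs_value_jump w hpos] at h1
      have h2 := (abs_value_mem_Icc_of_isNegativeBasis h (q := NetPath.const i j)
        (by simp [NetPath.IsNegativeBasis, NetPath.nonSkeletonCount_const, hi])).1
      rw [NetPath.abs_value_const] at h2
      have h3 : Real.exp (-γ) * |w.normalize.hidden l j k| ≤ γ :=
        (mul_le_mul_of_nonneg_right h2 (abs_nonneg _)).trans h1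
      calc |w.normalize.hidden l j k|
          = Real.exp (-γ) * |w.normalize.hidden l j k| * Real.exp γ := by
            rw [mul_right_comm, ← Real.exp_add]; simp
        _ ≤ γ * Real.exp γ := by gcongr)
  rw [mul_pow, ← Real.exp_nat_mul, Nat.cast_ofNat, one_pow, ← mul_assoc] at this
  exact this

end ReLUNet

/-! ### McDiarmid's inequality and symmetrization -/

theorem integrable_of_abs_le {Ω : Type*} [MeasurableSpace Ω] {μ : Measure Ω} [IsFiniteMeasure μ]
    {f : Ω → ℝ} (hf : Measurable f) {C : ℝ} (hC : ∀ x, |f x| ≤ C) : Integrable f μ :=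
  Integrable.of_bound hf.aestronglyMeasurable C (ae_of_all _ hC)

theorem abs_integral_le_of_abs_le {Ω : Type*} [MeasurableSpace Ω] {μ : Measure Ω}
    [IsProbabilityMeasure μ] {f : Ω → ℝ} {C : ℝ} (hC : ∀ x, |f x| ≤ C) : |∫ x, f x ∂μ| ≤ C := by
  simpa using norm_integral_le_of_norm_le_const (μ := μ) (f := f) (ae_of_all _ hC)

theorem integral_comp_of_measurable {α β : Type*} [MeasurableSpace α] [MeasurableSpace β]
    {μ : Measure α} {ν : Measure β} {φ : α → β} (hφ : MeasurePreserving φ μ ν) {f : β → ℝ}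
    (hf : Measurable f) : ∫ x, f (φ x) ∂μ = ∫ y, f y ∂ν := by
  rw [← hφ.map_eq, integral_map hφ.measurable.aemeasurable hf.aestronglyMeasurable]

/-- **McDiarmid's inequality**, at the level of moment generating functions: a function of `n`
independent variables which changes by at most `c` when one of them changes is sub-Gaussian with
variance proxy `n (c / 2) ^ 2`. The variables are integrated out one at a time, and Hoeffding's
lemma is applied to the partial mean as a function of the remaining variable. -/
theorem hasSubgaussianMGF_of_bounded_differences {Z : Type*} [MeasurableSpace Z] (P : Measure Z)
    [IsProbabilityMeasure P] {c : ℝ} {n : ℕ} (f : (Fin n → Z) → ℝ)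
    (hf : Measurable f) {C : ℝ} (hC : ∀ S, |f S| ≤ C)
    (hc : ∀ S i z, |f (Function.update S i z) - f S| ≤ c) :
    ProbabilityTheory.HasSubgaussianMGF
      (fun S => f S - ∫ S', f S' ∂(Measure.pi fun _ : Fin n => P)) (n * (‖c‖₊ / 2) ^ 2)
      (Measure.pi fun _ : Fin n => P) := by
  induction n with
  | zero =>
    have h0 : (fun S => f S - ∫ S', f S' ∂(Measure.pi fun _ : Fin 0 => P)) = fun _ => 0 := by
      funext S
      have : f = fun _ => f S := by
        funext S'
        rw [Subsingleton.elim S' S]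
      rw [this]
      simp
    rw [h0]
    simp
  | succ n ih =>
    set e := (MeasurableEquiv.piFinSuccAbove (fun _ : Fin (n + 1) => Z) 0).symm with he
    have hmp : MeasurePreserving e (P.prod (Measure.pi fun _ : Fin n => P))
        (Measure.pi fun _ : Fin (n + 1) => P) :=
      (measurePreserving_piFinSuccAbove (fun _ : Fin (n + 1) => P) 0).symm
    have hcons : ∀ z S, e (z, S) = Fin.cons z S := by
      intro z S
      simp [he, MeasurableEquiv.piFinSuccAbove_symm_apply, Fin.insertNthEquiv]
    have hm2 : Measurable fun p : Z × (Fin n → Z) => f (e p) := hf.comp e.measurable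
    have hm1 : ∀ z, Measurable fun S => f (e (z, S)) := fun z => hm2.comp measurable_prodMk_left
    set g : Z → ℝ := fun z => ∫ S, f (e (z, S)) ∂(Measure.pi fun _ : Fin n => P) with hg
    have hgm : Measurable g := hm2.stronglyMeasurable.integral_prod_right'.measurable
    have hgC : ∀ z, |g z| ≤ C := fun z => abs_integral_le_of_abs_le fun S => hC _
    have hint : ∀ z, Integrable (fun S => f (e (z, S))) (Measure.pi fun _ : Fin n => P) :=
      fun z => integrable_of_abs_le (hm1 z) fun S => hC _
    have hgg : ∀ z z', |g z - g z'| ≤ c := by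
      intro z z'
      rw [hg, ← integral_sub (hint z) (hint z')]
      refine abs_integral_le_of_abs_le fun S => ?_
      have := hc (Fin.cons z' S) 0 z
      rwa [Fin.update_cons_zero, ← hcons, ← hcons] at this
    have hm : ∫ S, f S ∂(Measure.pi fun _ : Fin (n + 1) => P) = ∫ z, g z ∂P := by
      rw [← hmp.integral_comp', integral_prod]
      exact integrable_of_abs_le hm2 fun p => hC _
    have hnon : Nonempty Z := nonempty_of_isProbabilityMeasure P
    have hbdd : BddBelow (Set.range g) := ⟨-C, by
      rintro _ ⟨z, rfl⟩
      exact (abs_le.1 (hgC z)).1⟩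
    have hgsub := ProbabilityTheory.hasSubgaussianMGF_of_mem_Icc (μ := P) (X := g)
      (a := ⨅ z, g z) (b := (⨅ z, g z) + c) hgm.aemeasurable (ae_of_all _ fun z => by
        refine ⟨ciInf_le hbdd z, ?_⟩
        have : g z - c ≤ ⨅ z, g z := le_ciInf fun z' => by
          have := (abs_le.1 (hgg z z')).2
          linarith
        linarith)
    rw [add_sub_cancel_left] at hgsub
    have hfsub := fun z => ih (fun S => f (e (z, S))) (hm1 z) (fun S => hC _) (by
      intro S i z'
      have := hc (Fin.cons z S) i.succ z'
      rwa [← Fin.cons_update, ← hcons, ← hcons] at this)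
    have hexp : ∀ t : ℝ, ∀ {Ω : Type _} [MeasurableSpace Ω] (μ : Measure Ω) [IsProbabilityMeasure μ]
        (F : Ω → ℝ) (m : ℝ), Measurable F → (∀ x, |F x| ≤ C) →
        Integrable (fun x => Real.exp (t * (F x - m))) μ := by
      intro t Ω _ μ _ F m hF hFC
      refine integrable_of_abs_le (C := Real.exp (|t| * (C + |m|))) (by fun_prop) fun x => ?_
      rw [abs_of_pos (Real.exp_pos _), Real.exp_le_exp]
      refine (le_abs_self _).trans ?_
      rw [abs_mul]
      gcongr
      exact (abs_sub _ _).trans (by gcongr; exact hFC x)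
    refine ⟨fun t => hexp t _ f _ hf hC, fun t => ?_⟩
    rw [ProbabilityTheory.mgf, hm, ← hmp.integral_comp',
      integral_prod _ (hexp t _ (fun p => f (e p)) _ hm2 fun p => hC _)]
    have hstep : ∀ z, ∫ S, Real.exp (t * (f (e (z, S)) - ∫ z, g z ∂P))
        ∂(Measure.pi fun _ : Fin n => P) ≤
        Real.exp ((n * (‖c‖₊ / 2) ^ 2 : NNReal) * t ^ 2 / 2) *
          Real.exp (t * (g z - ∫ z, g z ∂P)) := by
      intro z
      have h1 : ∀ S, Real.exp (t * (f (e (z, S)) - ∫ z, g z ∂P)) =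
          Real.exp (t * (f (e (z, S)) - g z)) * Real.exp (t * (g z - ∫ z, g z ∂P)) := by
        intro S
        rw [← Real.exp_add]
        ring_nf
      simp only [h1]
      rw [integral_mul_const]
      gcongr
      exact (hfsub z).mgf_le t
    calc _ ≤ ∫ z, Real.exp ((n * (‖c‖₊ / 2) ^ 2 : NNReal) * t ^ 2 / 2) *
          Real.exp (t * (g z - ∫ z, g z ∂P)) ∂P := by
          refine integral_mono ?_ ((hexp t P g _ hgm hgC).const_mul _) hstep
          exact (hexp t (P.prod (Measure.pi fun _ : Fin n => P)) (fun p => f (e p)) _ hm2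
            fun p => hC _).integral_prod_left
      _ ≤ Real.exp ((n * (‖c‖₊ / 2) ^ 2 : NNReal) * t ^ 2 / 2) *
          Real.exp (((‖c‖₊ / 2) ^ 2 : NNReal) * t ^ 2 / 2) := by
          rw [integral_const_mul]
          gcongr
          exact hgsub.mgf_le t
      _ = _ := by
          rw [← Real.exp_add]
          congr 1
          push_cast
          ring

theorem bddAbove_range_of_abs_le {ι : Type*} {a : ι → ℝ} {C : ℝ} (h : ∀ k, |a k| ≤ C) :
    BddAbove (Set.range a) :=
  ⟨C, by rintro _ ⟨k, rfl⟩; exact (abs_le.1 (h k)).2⟩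

theorem abs_ciSup_le_of_abs_le {ι : Type*} [Nonempty ι] {a : ι → ℝ} {C : ℝ}
    (h : ∀ k, |a k| ≤ C) : |⨆ k, a k| ≤ C := by
  have k := Classical.arbitrary ι
  exact abs_le.2 ⟨(abs_le.1 (h k)).1.trans (le_ciSup (bddAbove_range_of_abs_le h) k),
    ciSup_le fun k => (abs_le.1 (h k)).2⟩

theorem abs_ciSup_sub_ciSup_le {ι : Type*} [Nonempty ι] {a b : ι → ℝ} {C D r : ℝ}
    (ha : ∀ k, |a k| ≤ C) (hb : ∀ k, |b k| ≤ D) (h : ∀ k, |a k - b k| ≤ r) :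
    |(⨆ k, a k) - ⨆ k, b k| ≤ r := by
  have ha' := bddAbove_range_of_abs_le ha
  have hb' := bddAbove_range_of_abs_le hb
  have h1 : ⨆ k, a k ≤ (⨆ k, b k) + r := ciSup_le fun k => by
    have := le_ciSup hb' k
    have := (abs_le.1 (h k)).2
    linarith
  have h2 : ⨆ k, b k ≤ (⨆ k, a k) + r := ciSup_le fun k => by
    have := le_ciSup ha' k
    have := (abs_le.1 (h k)).1
    linarith
  exact abs_le.2 ⟨by linarith, by linarith⟩

/-- The empirical Rademacher complexity (without absolute values) of the class `h` on the
sample `S`. -/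
noncomputable def rademacherComplexity {ι Z : Type*} {n : ℕ} (h : ι → Z → ℝ) (S : Fin n → Z) : ℝ :=
  (2 ^ n : ℝ)⁻¹ * ∑ σ, ⨆ k, (n : ℝ)⁻¹ * rademacherSum σ (fun i => h k (S i))

/-- The largest excess of the true mean over the empirical mean on the sample `S` for functions
of the class `h`. -/
noncomputable def uniformDeviation {ι Z : Type*} [MeasurableSpace Z] (P : Measure Z) {n : ℕ}
    (h : ι → Z → ℝ) (S : Fin n → Z) : ℝ :=
  ⨆ k, (∫ z, h k z ∂P - (n : ℝ)⁻¹ * ∑ i, h k (S i))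

theorem rademacherSum_one {n : ℕ} (y : Fin n → ℝ) : rademacherSum 1 y = ∑ i, y i := by
  simp [rademacherSum]

theorem rademacherSum_sub {n : ℕ} (σ : Fin n → ℤˣ) (y z : Fin n → ℝ) :
    rademacherSum σ (fun i => y i - z i) = rademacherSum σ y - rademacherSum σ z := by
  simp [rademacherSum, mul_sub]

theorem abs_inv_mul_rademacherSum_le {n : ℕ} (σ : Fin n → ℤˣ) {y : Fin n → ℝ} {r : ℝ} (hr : 0 ≤ r)
    (hy : ∀ i, |y i| ≤ r) : |(n : ℝ)⁻¹ * rademacherSum σ y| ≤ r := by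
  have h1 : |rademacherSum σ y| ≤ n * r := by
    refine (Finset.abs_sum_le_sum_abs _ _).trans ?_
    calc ∑ i, |((σ i : ℤ) : ℝ) • y i| ≤ ∑ _i : Fin n, r := by
          refine Finset.sum_le_sum fun i _ => ?_
          rw [smul_eq_mul, abs_mul, abs_units_int, one_mul]
          exact hy i
      _ = n * r := by simp
  rw [abs_mul, abs_of_nonneg (by positivity)]
  rcases Nat.eq_zero_or_pos n with rfl | hn
  · simpa using hr
  · have : (0 : ℝ) < n := by exact_mod_cast hn
    calc (n : ℝ)⁻¹ * |rademacherSum σ y| ≤ (n : ℝ)⁻¹ * (n * r) := by gcongr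
      _ = r := by field_simp

theorem abs_rademacherSum_update_sub_le {Z : Type*} {n : ℕ} (σ : Fin n → ℤˣ) {h : Z → ℝ}
    (hb : ∀ z, |h z| ≤ 1) (S : Fin n → Z) (i : Fin n) (z : Z) :
    |rademacherSum σ (fun j => h (Function.update S i z j)) - rademacherSum σ (fun j => h (S j))|
      ≤ 2 := by
  rw [← rademacherSum_sub, rademacherSum, Finset.sum_eq_single i]
  · rw [Function.update_self, smul_eq_mul, abs_mul, abs_units_int, one_mul]
    have h1 := abs_le.1 (hb z)
    have h2 := abs_le.1 (hb (S i))
    exact abs_le.2 ⟨by linarith, by linarith⟩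
  · intro j _ hj
    simp [Function.update_of_ne hj]
  · simp

theorem measurable_rademacherSum {Ω : Type*} [MeasurableSpace Ω] {n : ℕ} (σ : Fin n → ℤˣ)
    {F : Fin n → Ω → ℝ} (hF : ∀ i, Measurable (F i)) :
    Measurable fun x => rademacherSum σ (fun i => F i x) := by
  unfold rademacherSum
  fun_prop

theorem measurable_iSup_rademacherSum {ι Z : Type*} [Countable ι] [MeasurableSpace Z] {n : ℕ}
    {h : ι → Z → ℝ} (hm : ∀ k, Measurable (h k)) (σ : Fin n → ℤˣ) :
    Measurable fun S : Fin n → Z => ⨆ k, (n : ℝ)⁻¹ * rademacherSum σ (fun i => h k (S i)) :=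
  Measurable.iSup fun k => (measurable_rademacherSum σ fun i =>
    (hm k).comp (measurable_pi_apply i)).const_mul _

theorem measurable_rademacherComplexity {ι Z : Type*} [Countable ι] [MeasurableSpace Z] {n : ℕ}
    {h : ι → Z → ℝ} (hm : ∀ k, Measurable (h k)) :
    Measurable fun S : Fin n → Z => rademacherComplexity h S :=
  (Finset.measurable_sum _ fun σ _ => measurable_iSup_rademacherSum hm σ).const_mul _

theorem measurable_uniformDeviation {ι Z : Type*} [Countable ι] [MeasurableSpace Z]
    (P : Measure Z) {n : ℕ} {h : ι → Z → ℝ} (hm : ∀ k, Measurable (h k)) :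
    Measurable fun S : Fin n → Z => uniformDeviation P h S :=
  Measurable.iSup fun k => ((Finset.measurable_sum _ fun i _ =>
    (hm k).comp (measurable_pi_apply i)).const_mul _).const_sub _

theorem abs_iSup_rademacherSum_le {ι Z : Type*} [Nonempty ι] {n : ℕ} {h : ι → Z → ℝ}
    (hb : ∀ k z, |h k z| ≤ 1) (σ : Fin n → ℤˣ) (S : Fin n → Z) :
    |⨆ k, (n : ℝ)⁻¹ * rademacherSum σ (fun i => h k (S i))| ≤ 1 :=
  abs_ciSup_le_of_abs_le fun k => abs_inv_mul_rademacherSum_le σ zero_le_one fun i => hb k (S i)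

theorem abs_average_signs_le {n : ℕ} {a : (Fin n → ℤˣ) → ℝ} {r : ℝ} (ha : ∀ σ, |a σ| ≤ r) :
    |(2 ^ n : ℝ)⁻¹ * ∑ σ, a σ| ≤ r := by
  have h1 : |∑ σ, a σ| ≤ 2 ^ n * r := by
    refine (Finset.abs_sum_le_sum_abs _ _).trans ?_
    calc ∑ σ, |a σ| ≤ ∑ _σ : Fin n → ℤˣ, r := Finset.sum_le_sum fun σ _ => ha σ
      _ = 2 ^ n * r := by simp
  rw [abs_mul, abs_of_nonneg (by positivity)]
  calc _ ≤ (2 ^ n : ℝ)⁻¹ * (2 ^ n * r) := by gcongr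
    _ = r := by field_simp

theorem abs_rademacherComplexity_le {ι Z : Type*} [Nonempty ι] {n : ℕ} {h : ι → Z → ℝ}
    (hb : ∀ k z, |h k z| ≤ 1) (S : Fin n → Z) : |rademacherComplexity h S| ≤ 1 :=
  abs_average_signs_le fun σ => abs_iSup_rademacherSum_le hb σ S

theorem abs_deviation_le {Z : Type*} [MeasurableSpace Z] (P : Measure Z) [IsProbabilityMeasure P]
    {n : ℕ} {h : Z → ℝ} (hb : ∀ z, |h z| ≤ 1) (S : Fin n → Z) :
    |∫ z, h z ∂P - (n : ℝ)⁻¹ * ∑ i, h (S i)| ≤ 2 := by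
  have h1 := abs_integral_le_of_abs_le (μ := P) hb
  have h2 := abs_inv_mul_rademacherSum_le 1 zero_le_one fun i => hb (S i)
  rw [rademacherSum_one] at h2
  exact (abs_sub _ _).trans (by linarith)

theorem abs_uniformDeviation_le {ι Z : Type*} [Nonempty ι] [MeasurableSpace Z] (P : Measure Z)
    [IsProbabilityMeasure P] {n : ℕ} {h : ι → Z → ℝ} (hb : ∀ k z, |h k z| ≤ 1) (S : Fin n → Z) :
    |uniformDeviation P h S| ≤ 2 :=
  abs_ciSup_le_of_abs_le fun k => abs_deviation_le P (hb k) S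

/-- Changing one point of the sample changes the Rademacher complexity by at most `2 / n`. -/
theorem abs_rademacherComplexity_update_sub_le {ι Z : Type*} [Nonempty ι] {n : ℕ} {h : ι → Z → ℝ}
    (hb : ∀ k z, |h k z| ≤ 1) (S : Fin n → Z) (i : Fin n) (z : Z) :
    |rademacherComplexity h (Function.update S i z) - rademacherComplexity h S| ≤ 2 / n := by
  rw [rademacherComplexity, rademacherComplexity, ← mul_sub, ← Finset.sum_sub_distrib]
  refine abs_average_signs_le fun σ => ?_
  refine abs_ciSup_sub_ciSup_le
    (fun k => abs_inv_mul_rademacherSum_le σ zero_le_one fun j => hb k _)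
    (fun k => abs_inv_mul_rademacherSum_le σ zero_le_one fun j => hb k _) fun k => ?_
  rw [← mul_sub, abs_mul, abs_of_nonneg (by positivity), div_eq_inv_mul]
  gcongr
  exact abs_rademacherSum_update_sub_le σ (hb k) S i z

/-- Changing one point of the sample changes the uniform deviation by at most `2 / n`. -/
theorem abs_uniformDeviation_update_sub_le {ι Z : Type*} [Nonempty ι] [MeasurableSpace Z]
    (P : Measure Z) [IsProbabilityMeasure P] {n : ℕ} {h : ι → Z → ℝ} (hb : ∀ k z, |h k z| ≤ 1)
    (S : Fin n → Z) (i : Fin n) (z : Z) :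
    |uniformDeviation P h (Function.update S i z) - uniformDeviation P h S| ≤ 2 / n := by
  refine abs_ciSup_sub_ciSup_le (fun k => abs_deviation_le P (hb k) _)
    (fun k => abs_deviation_le P (hb k) _) fun k => ?_
  rw [sub_sub_sub_cancel_left, ← mul_sub, abs_mul, abs_of_nonneg (by positivity), div_eq_inv_mul,
    abs_sub_comm]
  gcongr
  have := abs_rademacherSum_update_sub_le 1 (hb k) S i z
  rwa [rademacherSum_one, rademacherSum_one] at this

/-- **Symmetrization**: the expected uniform deviation is at most twice the expected Rademacher
complexity. The true mean is replaced by the mean over an independent ghost sample; the two samples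
are kept as one sample of pairs, whose law is invariant under swapping any of the pairs. -/
theorem integral_uniformDeviation_le {ι Z : Type*} [Countable ι] [Nonempty ι] [MeasurableSpace Z]
    (P : Measure Z) [IsProbabilityMeasure P] {n : ℕ} (hn : 0 < n) {h : ι → Z → ℝ}
    (hm : ∀ k, Measurable (h k)) (hb : ∀ k z, |h k z| ≤ 1) :
    ∫ S, uniformDeviation P h S ∂(Measure.pi fun _ : Fin n => P) ≤
      2 * ∫ S, rademacherComplexity h S ∂(Measure.pi fun _ : Fin n => P) := by
  set μ := Measure.pi fun _ : Fin n => P with hμ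
  set Q := Measure.pi fun _ : Fin n => P.prod P with hQ
  let T : (Fin n → ℤˣ) → (Fin n → Z × Z) → ℝ := fun σ q =>
    ⨆ k, (n : ℝ)⁻¹ * rademacherSum σ (fun i => h k (q i).2 - h k (q i).1)
  let A : (Fin n → ℤˣ) → (Fin n → Z) → ℝ := fun σ S =>
    ⨆ k, (n : ℝ)⁻¹ * rademacherSum σ (fun i => h k (S i))
  have hb2 : ∀ k (p : Z × Z), |h k p.2 - h k p.1| ≤ 2 := fun k p => by
    have h1 := abs_le.1 (hb k p.1)
    have h2 := abs_le.1 (hb k p.2)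
    exact abs_le.2 ⟨by linarith, by linarith⟩
  have hTk : ∀ (σ : Fin n → ℤˣ) (q : Fin n → Z × Z) k,
      |(n : ℝ)⁻¹ * rademacherSum σ (fun i => h k (q i).2 - h k (q i).1)| ≤ 2 :=
    fun σ q k => abs_inv_mul_rademacherSum_le σ zero_le_two fun i => hb2 k (q i)
  have hTb : ∀ σ q, |T σ q| ≤ 2 := fun σ q => abs_ciSup_le_of_abs_le (hTk σ q)
  have hTm : ∀ σ, Measurable (T σ) := fun σ => Measurable.iSup fun k =>
    (measurable_rademacherSum σ fun i => ((hm k).comp (measurable_snd.comp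
      (measurable_pi_apply i))).sub ((hm k).comp (measurable_fst.comp
        (measurable_pi_apply i)))).const_mul _
  have hAb : ∀ σ S, |A σ S| ≤ 1 := fun σ S => abs_iSup_rademacherSum_le hb σ S
  have hAm : ∀ σ, Measurable (A σ) := fun σ => measurable_iSup_rademacherSum hm σ
  have hfst : MeasurePreserving (fun (q : Fin n → Z × Z) i => (q i).1) Q μ :=
    measurePreserving_pi _ _ fun _ => measurePreserving_fst
  have hsnd : MeasurePreserving (fun (q : Fin n → Z × Z) i => (q i).2) Q μ :=
    measurePreserving_pi _ _ fun _ => measurePreserving_snd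
  set e := (MeasurableEquiv.arrowProdEquivProdArrow Z Z (Fin n)).symm with he
  have hemp : MeasurePreserving e (μ.prod μ) Q :=
    (measurePreserving_arrowProdEquivProdArrow Z Z (Fin n) (fun _ => P) (fun _ => P)).symm
  have hghost : ∫ S, uniformDeviation P h S ∂μ ≤ ∫ q, T 1 q ∂Q := by
    have hTe : Measurable fun p => T 1 (e p) := (hTm 1).comp e.measurable
    have hTi : Integrable (fun p => T 1 (e p)) (μ.prod μ) :=
      integrable_of_abs_le hTe fun p => hTb 1 _
    rw [← hemp.integral_comp', integral_prod _ hTi]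
    refine integral_mono (integrable_of_abs_le (measurable_uniformDeviation P hm)
      (abs_uniformDeviation_le P hb)) hTi.integral_prod_left fun S => ciSup_le fun k => ?_
    have hi : ∀ i : Fin n, Integrable (fun S' : Fin n → Z => h k (S' i)) μ := fun i =>
      integrable_of_abs_le ((hm k).comp (measurable_pi_apply i)) fun S' => hb k _
    have hi' : ∀ i : Fin n, Integrable (fun S' : Fin n → Z => h k (S' i) - h k (S i)) μ := fun i =>
      (hi i).sub (integrable_const _)
    have hmean : ∀ i : Fin n, ∫ S', h k (S' i) ∂μ = ∫ z, h k z ∂P := fun i =>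
      integral_comp_of_measurable (measurePreserving_eval (fun _ : Fin n => P) i) (hm k)
    have hn' : (n : ℝ) ≠ 0 := by exact_mod_cast hn.ne'
    calc ∫ z, h k z ∂P - (n : ℝ)⁻¹ * ∑ i, h k (S i)
        = ∫ S', (n : ℝ)⁻¹ * ∑ i, (h k (S' i) - h k (S i)) ∂μ := by
          rw [integral_const_mul, integral_finsetSum _ fun i _ => hi' i]
          have : ∀ i : Fin n, ∫ S', (h k (S' i) - h k (S i)) ∂μ = ∫ z, h k z ∂P - h k (S i) := by
            intro i
            rw [integral_sub (hi i) (integrable_const _), hmean]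
            simp
          simp only [this, Finset.sum_sub_distrib, Finset.sum_const, Finset.card_univ,
            Fintype.card_fin, nsmul_eq_mul]
          field_simp
      _ ≤ ∫ S', T 1 (e (S, S')) ∂μ := by
          refine integral_mono ((integrable_finsetSum _ fun i _ => hi' i).const_mul _)
            (integrable_of_abs_le (hTe.comp measurable_prodMk_left) fun S' => hTb 1 _) fun S' => ?_
          have := le_ciSup (bddAbove_range_of_abs_le (hTk 1 (e (S, S')))) k
          rw [rademacherSum_one] at this
          exact this
  have hswap : ∀ σ, ∫ q, T σ q ∂Q = ∫ q, T 1 q ∂Q := by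
    intro σ
    let F : Fin n → Z × Z → Z × Z := fun i => if σ i = 1 then id else Prod.swap
    have hF : MeasurePreserving (fun (q : Fin n → Z × Z) i => F i (q i)) Q Q :=
        measurePreserving_pi _ _ fun i => by
          simp only [F]
          split_ifs
          · exact MeasurePreserving.id _
          · exact Measure.measurePreserving_swap
    have hTF : ∀ q, T σ q = T 1 (fun i => F i (q i)) := by
      intro q
      simp only [T]
      congr 1
      funext k
      simp only [rademacherSum]
      congr 1
      refine Finset.sum_congr rfl fun i _ => ?_
      rcases Int.units_eq_one_or (σ i) with hs | hs
      · simp [F, hs]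
      · have : (-1 : ℤˣ) ≠ 1 := by decide
        simp [F, hs, this]
    simp only [hTF]
    exact integral_comp_of_measurable hF (hTm 1)
  have hsplit : ∀ σ, ∫ q, T σ q ∂Q ≤ ∫ S, A σ S ∂μ + ∫ S, A (-σ) S ∂μ := by
    intro σ
    have h1 : ∀ σ, Integrable (fun q : Fin n → Z × Z => A σ (fun i => (q i).2)) Q := fun σ =>
      integrable_of_abs_le ((hAm σ).comp hsnd.measurable) fun q => hAb σ _
    have h2 : ∀ σ, Integrable (fun q : Fin n → Z × Z => A σ (fun i => (q i).1)) Q := fun σ =>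
      integrable_of_abs_le ((hAm σ).comp hfst.measurable) fun q => hAb σ _
    have h3 : ∫ S, A σ S ∂μ = ∫ q, A σ (fun i => (q i).2) ∂Q :=
      (integral_comp_of_measurable hsnd (hAm σ)).symm
    have h4 : ∫ S, A (-σ) S ∂μ = ∫ q, A (-σ) (fun i => (q i).1) ∂Q :=
      (integral_comp_of_measurable hfst (hAm (-σ))).symm
    rw [h3, h4, ← integral_add (h1 σ) (h2 (-σ))]
    refine integral_mono (integrable_of_abs_le (hTm σ) (hTb σ)) ((h1 σ).add (h2 (-σ)))
      fun q => ciSup_le fun k => ?_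
    rw [rademacherSum_sub, mul_sub, sub_eq_add_neg, ← mul_neg, ← rademacherSum_neg]
    have hk : ∀ (σ : Fin n → ℤˣ) (S : Fin n → Z),
        (n : ℝ)⁻¹ * rademacherSum σ (fun i => h k (S i)) ≤ A σ S := fun σ S =>
      le_ciSup (f := fun k => (n : ℝ)⁻¹ * rademacherSum σ (fun i => h k (S i)))
        (bddAbove_range_of_abs_le fun k =>
          abs_inv_mul_rademacherSum_le σ zero_le_one fun i => hb k (S i)) k
    exact add_le_add (hk _ _) (hk _ _)
  have hcomplexity : ∫ S, rademacherComplexity h S ∂μ = (2 ^ n : ℝ)⁻¹ * ∑ σ, ∫ S, A σ S ∂μ := by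
    rw [← integral_finsetSum _ fun σ _ => integrable_of_abs_le (hAm σ) (hAb σ),
      ← integral_const_mul]
    rfl
  have hsum := Finset.sum_le_sum fun σ (_ : σ ∈ Finset.univ) => hsplit σ
  simp only [hswap] at hsum
  rw [Finset.sum_const, card_signs, nsmul_eq_mul, Finset.sum_add_distrib] at hsum
  have hneg : ∑ σ, ∫ S, A (-σ) S ∂μ = ∑ σ, ∫ S, A σ S ∂μ :=
    Equiv.sum_comp (Equiv.neg (Fin n → ℤˣ)) fun σ => ∫ S, A σ S ∂μ
  rw [hneg] at hsum
  push_cast at hsum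
  refine hghost.trans ?_
  rw [hcomplexity]
  have h2n : (0 : ℝ) < 2 ^ n := by positivity
  calc ∫ q, T 1 q ∂Q = (2 ^ n : ℝ)⁻¹ * (2 ^ n * ∫ q, T 1 q ∂Q) := by field_simp
    _ ≤ (2 ^ n : ℝ)⁻¹ * (∑ σ, ∫ S, A σ S ∂μ + ∑ σ, ∫ S, A σ S ∂μ) := by gcongr
    _ = 2 * ((2 ^ n : ℝ)⁻¹ * ∑ σ, ∫ S, A σ S ∂μ) := by ring

/-- One-sided generalization bound in terms of the empirical Rademacher complexity: McDiarmid's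
inequality for the difference `uniformDeviation - 2 * rademacherComplexity`, whose mean is
nonpositive by symmetrization and which changes by at most `6 / n` with one point of the sample. -/
theorem measureReal_le_uniformDeviation_sub_le {ι Z : Type*} [Countable ι] [Nonempty ι]
    [MeasurableSpace Z] (P : Measure Z) [IsProbabilityMeasure P] {n : ℕ} (hn : 0 < n)
    {h : ι → Z → ℝ} (hm : ∀ k, Measurable (h k)) (hb : ∀ k z, |h k z| ≤ 1) {ε : ℝ} (hε : 0 ≤ ε) :
    (Measure.pi fun _ : Fin n => P).real
      {S | ε ≤ uniformDeviation P h S - 2 * rademacherComplexity h S} ≤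
      Real.exp (-(ε ^ 2 * n / 18)) := by
  set μ := Measure.pi fun _ : Fin n => P with hμ
  have hUm := measurable_uniformDeviation (n := n) P hm
  have hRm := measurable_rademacherComplexity (n := n) hm
  have hsub := hasSubgaussianMGF_of_bounded_differences P (n := n) (c := 6 / n) (C := 4)
    (fun S => uniformDeviation P h S - 2 * rademacherComplexity h S) (hUm.sub (hRm.const_mul 2))
    (fun S => by
      have h1 := abs_le.1 (abs_uniformDeviation_le P hb S)
      have h2 := abs_le.1 (abs_rademacherComplexity_le hb S)
      exact abs_le.2 ⟨by linarith, by linarith⟩)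
    (fun S i z => by
      have h1 := abs_le.1 (abs_uniformDeviation_update_sub_le P hb S i z)
      have h2 := abs_le.1 (abs_rademacherComplexity_update_sub_le hb S i z)
      have h3 : (6 : ℝ) / n = 2 / n + 2 * (2 / n) := by ring
      rw [h3]
      exact abs_le.2 ⟨by linarith, by linarith⟩)
  have hmean : ∫ S, (uniformDeviation P h S - 2 * rademacherComplexity h S) ∂μ ≤ 0 := by
    rw [integral_sub (integrable_of_abs_le hUm (abs_uniformDeviation_le P hb))
      ((integrable_of_abs_le hRm (abs_rademacherComplexity_le hb)).const_mul 2),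
      integral_const_mul]
    linarith [integral_uniformDeviation_le P hn hm hb]
  refine (measureReal_mono fun S (hS : ε ≤ _) => ?_).trans ((hsub.measure_ge_le hε).trans_eq ?_)
  · change ε ≤ _ - _
    linarith
  · have hn' : (n : ℝ) ≠ 0 := by exact_mod_cast hn.ne'
    congr 1
    push_cast
    rw [Real.norm_eq_abs, abs_of_nonneg (by positivity)]
    field_simp
    ring

/-! ### Rademacher complexity of the loss class -/

theorem sum_iSup_le_of_forall_choice {n : ℕ} {ι : Type*} [Nonempty ι]
    {F : (Fin n → ℤˣ) → ι → ℝ} {K : ℝ}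
    (hK : ∀ c : (Fin n → ℤˣ) → ι, ∑ σ, F σ (c σ) ≤ K) : ∑ σ, ⨆ k, F σ k ≤ K := by
  refine le_of_forall_pos_le_add fun ε hε => ?_
  have h2n : (0 : ℝ) < 2 ^ n := by positivity
  have := fun σ => exists_lt_of_lt_ciSup (f := F σ)
    (sub_lt_self (⨆ k, F σ k) (div_pos hε h2n))
  choose c hc using this
  have h1 : ∑ σ, ((⨆ k, F σ k) - ε / 2 ^ n) ≤ ∑ σ, F σ (c σ) :=
    Finset.sum_le_sum fun σ _ => (hc σ).le
  rw [Finset.sum_sub_distrib, Finset.sum_const, card_signs, nsmul_eq_mul] at h1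
  push_cast at h1
  rw [mul_div_cancel₀ _ h2n.ne'] at h1
  linarith [hK c]

/-- Rademacher complexity of the networks of basis-path norm at most `γ`: each network is replaced
by its normalization, and the layers are peeled off one by one. -/
theorem sum_norm_rademacherSum_eval_le {d H L n : ℕ} [NeZero H] (hd : 1 ≤ d) {γ : ℝ}
    (x : Fin n → EuclideanSpace ℝ (Fin d)) {r : ℝ} (hr : 0 ≤ r) (hx : ∀ i, ‖x i‖ ≤ r)
    (w : (Fin n → ℤˣ) → ReLUNet d H L)
    (hw : ∀ σ, ((basisPathNorm (w σ) : ℝ≥0∞) : EReal) ≤ (γ : EReal)) :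
    ∑ σ, ‖WithLp.toLp 2 (rademacherSum σ (fun i => (w σ).eval (x i)))‖ ≤
      (2 * √H * √(1 + ((H : ℝ) - 1) * γ ^ 2 * Real.exp (2 * γ))) ^ (L - 2) *
        (2 * √H * √(Real.exp (2 * γ) + ((d : ℝ) - 1) * γ ^ 2) * (2 ^ n * (√n * r))) := by
  set ρ₁ := √(Real.exp (2 * γ) + ((d : ℝ) - 1) * γ ^ 2) with hρ₁
  have hfirst := fun (c : (Fin n → ℤˣ) → {M : Matrix (Fin d) (Fin H) ℝ //
      ∀ j, ‖WithLp.toLp 2 (fun i => M i j)‖ ≤ ρ₁}) =>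
    sum_norm_rademacherSum_reluLayer_le (W := Unit) (n := n) (fun _ i a => x i a)
      (fun _ => sum_norm_rademacherSum_le (fun i a => x i a) hr hx) (Real.sqrt_nonneg _)
      (fun _ => ()) (fun σ => (c σ).1) (fun σ => (c σ).2)
  have := sum_norm_rademacherSum_reluLayers_le (n := n)
    (W := {M : Matrix (Fin d) (Fin H) ℝ // ∀ j, ‖WithLp.toLp 2 (fun i => M i j)‖ ≤ ρ₁})
    (fun M i => reluLayer M.1 (fun a => x i a)) hfirst
    (ρ := √(1 + ((H : ℝ) - 1) * γ ^ 2 * Real.exp (2 * γ))) (Real.sqrt_nonneg _) (L - 2)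
    (fun σ => ⟨(w σ).normalize.first, ReLUNet.norm_normalize_first_le hd (hw σ)⟩)
    (fun σ => (w σ).normalize.hidden) (fun σ => ReLUNet.norm_normalize_hidden_le hd (hw σ))
  refine le_trans (le_of_eq ?_) this
  refine Finset.sum_congr rfl fun σ _ => ?_
  congr 2
  congr 1
  funext i
  rw [← ReLUNet.eval_normalize (w σ) (fun l j => ReLUNet.tail_pos hd (hw σ) l j)]
  rfl

/-- The Rademacher complexity of the loss class on a sample is at most the second summand of the
generalization bound. -/
theorem rademacherComplexity_loss_le {ι : Type*} [Nonempty ι] {d H L n : ℕ} (hd : 1 ≤ d)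
    (hH : 1 ≤ H) (hL : 2 ≤ L) (hn : 1 ≤ n) {γ : ℝ} (v : EuclideanSpace ℝ (Fin H))
    (ℓ : ℝ → Fin 2 → ℝ) (hlip : ∀ y, LipschitzWith 1 (fun t => ℓ t y))
    (w : ι → ReLUNet d H L) (hw : ∀ k, ((basisPathNorm (w k) : ℝ≥0∞) : EReal) ≤ (γ : EReal))
    (S : Fin n → EuclideanSpace ℝ (Fin d) × Fin 2) :
    rademacherComplexity (fun k z => ℓ (∑ j, v j * (w k).eval z.1 j) z.2) S ≤
      √(2 * basisPathMeasure γ d H L * (4 * (H : ℝ)) ^ (L - 1) * ‖v‖ ^ 2 *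
        (⨆ i, ‖(S i).1‖ ^ 2) / n) := by
  have : NeZero H := ⟨by omega⟩
  set m : ℝ := ⨆ i, ‖(S i).1‖ ^ 2 with hm
  have hle : ∀ i, ‖(S i).1‖ ^ 2 ≤ m := fun i =>
    le_ciSup (f := fun i => ‖(S i).1‖ ^ 2) (Set.finite_range _).bddAbove i
  have hm0 : 0 ≤ m := (sq_nonneg _).trans (hle ⟨0, hn⟩)
  set q₁ : ℝ := Real.exp (2 * γ) + ((d : ℝ) - 1) * γ ^ 2 with hq₁
  set q : ℝ := 1 + ((H : ℝ) - 1) * γ ^ 2 * Real.exp (2 * γ) with hq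
  have hd' : (1 : ℝ) ≤ d := by exact_mod_cast hd
  have hH' : (1 : ℝ) ≤ H := by exact_mod_cast hH
  have hn' : (0 : ℝ) < n := by exact_mod_cast hn
  have hq₁0 : 0 ≤ q₁ :=
    add_nonneg (Real.exp_pos _).le (mul_nonneg (by linarith) (sq_nonneg _))
  have hq0 : 0 ≤ q := add_nonneg zero_le_one
    (mul_nonneg (mul_nonneg (by linarith) (sq_nonneg _)) (Real.exp_pos _).le)
  set K : ℝ := (2 * √H * √q) ^ (L - 2) * (2 * √H * √q₁ * (2 ^ n * (√n * √m))) with hK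
  have hchoice : ∑ σ, ⨆ k, (n : ℝ)⁻¹ * rademacherSum σ
      (fun i => ℓ (∑ j, v j * (w k).eval (S i).1 j) (S i).2) ≤ (n : ℝ)⁻¹ * (‖v‖ * K) := by
    refine sum_iSup_le_of_forall_choice fun c => ?_
    rw [← Finset.mul_sum]
    gcongr
    obtain ⟨c', hc'⟩ := exists_sum_rademacherSum_le
      (fun i k => ℓ (∑ j, v j * (w k).eval (S i).1 j) (S i).2)
      (fun i k => ∑ j, v j * (w k).eval (S i).1 j) (fun i a b => by
        simpa [Real.dist_eq] using (hlip (S i).2).dist_le_mul _ _) c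
    refine hc'.trans ?_
    calc ∑ σ, rademacherSum σ (fun i => ∑ j, v j * (w (c' σ)).eval (S i).1 j)
        ≤ ∑ σ, ‖v‖ * ‖WithLp.toLp 2 (rademacherSum σ (fun i => (w (c' σ)).eval (S i).1))‖ := by
          refine Finset.sum_le_sum fun σ _ => ?_
          have h1 := dotProduct_rademacherSum σ (fun j => v j)
            (fun i => (w (c' σ)).eval (S i).1)
          simp only [dotProduct] at h1
          rw [← h1]
          exact (le_abs_self _).trans (abs_dotProduct_le_norm_mul_norm _ _)
      _ ≤ ‖v‖ * K := by
          rw [← Finset.mul_sum]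
          gcongr
          exact sum_norm_rademacherSum_eval_le hd (fun i => (S i).1) (Real.sqrt_nonneg m)
            (fun i => Real.le_sqrt_of_sq_le (hle i)) _ fun σ => hw _
  have hbound : rademacherComplexity (fun k z => ℓ (∑ j, v j * (w k).eval z.1 j) z.2) S ≤
      (2 ^ n : ℝ)⁻¹ * ((n : ℝ)⁻¹ * (‖v‖ * K)) := by
    rw [rademacherComplexity]
    gcongr
  refine hbound.trans (Real.le_sqrt_of_sq_le ?_)
  obtain ⟨p, rfl⟩ : ∃ p, L = p + 2 := ⟨L - 2, by omega⟩
  have hsq : ((2 ^ n : ℝ)⁻¹ * ((n : ℝ)⁻¹ * (‖v‖ * K))) ^ 2 =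
      (q₁ * q ^ p) * (4 * (H : ℝ)) ^ (p + 1) * ‖v‖ ^ 2 * m / n := by
    have e1 : √(H : ℝ) ^ 2 = H := Real.sq_sqrt (by positivity)
    have e2 : √q ^ 2 = q := Real.sq_sqrt hq0
    have e3 : √q₁ ^ 2 = q₁ := Real.sq_sqrt hq₁0
    have e4 : √(n : ℝ) ^ 2 = n := Real.sq_sqrt hn'.le
    have e5 : √m ^ 2 = m := Real.sq_sqrt hm0
    have e6 : ((2 * √(H : ℝ) * √q) ^ p) ^ 2 = (4 * H * q) ^ p := by
      rw [← pow_mul, mul_comm p 2, pow_mul, mul_pow (2 * √(H : ℝ)), mul_pow 2, e1, e2]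
      norm_num
    rw [hK, Nat.add_sub_cancel]
    simp only [mul_pow _ _ 2, e6, e1, e3, e4, e5]
    have h2n : (2 : ℝ) ^ n ≠ 0 := by positivity
    rw [mul_pow (4 * (H : ℝ)) q p, pow_succ]
    field_simp
    ring
  have hΦ : basisPathMeasure γ d H (p + 2) = H * (q₁ * q ^ p) := by
    rw [basisPathMeasure, Nat.add_sub_cancel, hq₁]
    ring
  rw [hsq, hΦ]
  have hpos : 0 ≤ (q₁ * q ^ p) * (4 * (H : ℝ)) ^ (p + 1) * ‖v‖ ^ 2 * m / n := by positivity
  calc _ ≤ 2 * H * ((q₁ * q ^ p) * (4 * (H : ℝ)) ^ (p + 1) * ‖v‖ ^ 2 * m / n) :=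
        le_mul_of_one_le_left hpos (by linarith)
    _ = _ := by
        rw [show p + 2 - 1 = p + 1 by omega]
        ring

/-! ### Separability and the generalization bound -/

/-- The space of all weights, as a product of spaces of real-valued functions; it carries the
topology in which a countable dense set of networks is chosen. -/
abbrev NetWeights (d H L : ℕ) : Type :=
  (Fin d → Fin H → ℝ) × (Fin (L - 2) → Fin H → Fin H → ℝ)

/-- The network with given weights. -/
def NetWeights.toNet {d H L : ℕ} (θ : NetWeights d H L) : ReLUNet d H L :=
  ⟨Matrix.of θ.1, fun l => Matrix.of (θ.2 l)⟩

theorem continuous_reluLayer {Θ : Type*} [TopologicalSpace Θ] {a b : ℕ}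
    {W : Θ → Fin a → Fin b → ℝ} (hW : Continuous W) {o : Θ → Fin a → ℝ} (ho : Continuous o) :
    Continuous fun θ => reluLayer (Matrix.of (W θ)) (o θ) := by
  unfold reluLayer
  simp only [Matrix.mulVec, dotProduct, Matrix.transpose_apply, Matrix.of_apply]
  fun_prop

theorem continuous_reluLayers {Θ : Type*} [TopologicalSpace Θ] {H : ℕ} (m : ℕ)
    {W : Θ → Fin m → Fin H → Fin H → ℝ} (hW : Continuous W) {o : Θ → Fin H → ℝ}
    (ho : Continuous o) :
    Continuous fun θ => reluLayers m (fun l => Matrix.of (W θ l)) (o θ) := by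
  induction m with
  | zero => exact ho
  | succ m ih =>
    have hW' : Continuous fun θ (l : Fin m) => W θ l.castSucc := by fun_prop
    have hl : Continuous fun θ => W θ (Fin.last m) := by fun_prop
    exact continuous_reluLayer hl (ih hW')

/-- The value of the network with readout `v` depends jointly continuously on weights and input. -/
theorem continuous_readout_eval {d H L : ℕ} (v : EuclideanSpace ℝ (Fin H)) :
    Continuous fun p : NetWeights d H L × EuclideanSpace ℝ (Fin d) =>
      ∑ k, v k * p.1.toNet.eval p.2 k := by
  have : Continuous fun p : NetWeights d H L × EuclideanSpace ℝ (Fin d) =>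
      p.1.toNet.eval p.2 := by
    refine continuous_reluLayers (L - 2)
      (W := fun p : NetWeights d H L × EuclideanSpace ℝ (Fin d) => p.1.2) (by fun_prop) ?_
    exact continuous_reluLayer
      (W := fun p : NetWeights d H L × EuclideanSpace ℝ (Fin d) => p.1.1)
      (by fun_prop) (by fun_prop)
  fun_prop

theorem measurable_loss {X : Type*} [MeasurableSpace X] {ℓ : ℝ → Fin 2 → ℝ}
    (hlip : ∀ y, LipschitzWith 1 (fun t => ℓ t y)) {g : X → ℝ} (hg : Measurable g) :
    Measurable fun z : X × Fin 2 => ℓ (g z.1) z.2 :=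
  measurable_from_prod_countable_left fun y => (hlip y).continuous.measurable.comp hg

/-- A bound on the deviation for a dense set of parameters bounds it for all parameters, since both
the empirical and the true risk are continuous in the parameter. -/
theorem abs_deviation_le_of_denseRange {Θ X ι : Type*} [TopologicalSpace Θ]
    [FirstCountableTopology Θ] [MeasurableSpace X] {n : ℕ} {ℓ : ℝ → Fin 2 → ℝ}
    (hlip : ∀ y, LipschitzWith 1 (fun t => ℓ t y)) (hbdd : ∀ t y, |ℓ t y| ≤ 1)
    (P : Measure (X × Fin 2)) [IsProbabilityMeasure P] {g : Θ → X → ℝ}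
    (hm : ∀ θ, Measurable (g θ)) (hc : ∀ x, Continuous fun θ => g θ x)
    {u : ι → Θ} (hu : DenseRange u) (S : Fin n → X × Fin 2) {b : ℝ}
    (hb : ∀ k, |(1 / (n : ℝ)) * ∑ i, ℓ (g (u k) (S i).1) (S i).2
      - ∫ z, ℓ (g (u k) z.1) z.2 ∂P| ≤ b) (θ : Θ) :
    |(1 / (n : ℝ)) * ∑ i, ℓ (g θ (S i).1) (S i).2 - ∫ z, ℓ (g θ z.1) z.2 ∂P| ≤ b := by
  have hℓ : ∀ z : X × Fin 2, Continuous fun θ => ℓ (g θ z.1) z.2 := fun z =>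
    (hlip z.2).continuous.comp (hc z.1)
  have hint : Continuous fun θ => ∫ z, ℓ (g θ z.1) z.2 ∂P :=
    continuous_of_dominated (bound := fun _ => 1)
      (fun θ => (measurable_loss hlip (hm θ)).aestronglyMeasurable)
      (fun θ => ae_of_all _ fun z => hbdd _ _) (integrable_const _) (ae_of_all _ hℓ)
  have hcont : Continuous fun θ =>
      |(1 / (n : ℝ)) * ∑ i, ℓ (g θ (S i).1) (S i).2 - ∫ z, ℓ (g θ z.1) z.2 ∂P| :=
    (((continuous_finsetSum _ fun i _ => hℓ (S i)).const_mul _).sub hint).abs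
  exact hu.induction_on (p := fun θ => |(1 / (n : ℝ)) * ∑ i, ℓ (g θ (S i).1) (S i).2
    - ∫ z, ℓ (g θ z.1) z.2 ∂P| ≤ b) θ (isClosed_le hcont continuous_const) hb

/-- The failure probability of the one-sided bound at the threshold of the theorem. -/
theorem exp_neg_threshold_le {n : ℕ} (hn : 1 ≤ n) {δ : ℝ} (hδ : 0 < δ) (hδ1 : δ ≤ 1) :
    Real.exp (-((4 * √(2 * Real.log (4 / δ) / n)) ^ 2 * n / 18)) ≤ δ / 2 := by
  have hn' : (0 : ℝ) < n := by exact_mod_cast hn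
  have h4 : 1 ≤ 4 / δ := by
    rw [le_div_iff₀ hδ]
    linarith
  have hlog : 0 ≤ Real.log (4 / δ) := Real.log_nonneg h4
  rw [mul_pow, Real.sq_sqrt (by positivity)]
  calc _ ≤ Real.exp (-Real.log (4 / δ)) := by
        rw [Real.exp_le_exp]
        have : (4 : ℝ) ^ 2 * (2 * Real.log (4 / δ) / n) * n / 18 = 32 / 18 * Real.log (4 / δ) := by
          field_simp
          ring
        rw [this]
        linarith
    _ = δ / 4 := by
        rw [Real.exp_neg, Real.exp_log (by positivity), inv_div]
    _ ≤ δ / 2 := by linarith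

theorem theorem3p1 (d H L n : ℕ) (hd : 1 ≤ d) (hH : 1 ≤ H) (hL : 2 ≤ L) (hn : 1 ≤ n)
    (γ : ℝ) (v : EuclideanSpace ℝ (Fin H))
    (ℓ : ℝ → Fin 2 → ℝ)
    (hlip : ∀ y, LipschitzWith 1 (fun t => ℓ t y))
    (hbdd : ∀ t y, |ℓ t y| ≤ 1)
    (P : Measure (EuclideanSpace ℝ (Fin d) × Fin 2)) [IsProbabilityMeasure P]
    (δ : ℝ) (hδ : 0 < δ) :
    Measure.pi (fun _ : Fin n => P)
      {S | ¬ genError (hypothesisSpace d H L γ v) ℓ P S ≤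
        ENNReal.ofReal
          (4 * Real.sqrt (2 * Real.log (4 / δ) / n) +
            2 * Real.sqrt
              (2 * basisPathMeasure γ d H L * (4 * (H : ℝ)) ^ (L - 1) * ‖v‖ ^ 2 *
                (⨆ i, ‖(S i).1‖ ^ 2) / n))}
      ≤ ENNReal.ofReal δ := by
  rcases le_or_gt 1 δ with hδ1 | hδ1
  · exact prob_le_one.trans (by simpa using hδ1)
  set A : Set (NetWeights d H L) := {θ | ((basisPathNorm θ.toNet : ℝ≥0∞) : EReal) ≤ (γ : EReal)}
    with hA
  rcases isEmpty_or_nonempty A with hempty | hnonempty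
  · -- An empty class has generalization error `0`.
    have : hypothesisSpace d H L γ v = ∅ := by
      refine Set.eq_empty_of_forall_notMem ?_
      rintro _ ⟨w, hw, rfl⟩
      exact hempty.false ⟨(w.first, w.hidden), hw⟩
    simp [genError, this]
  set u : ℕ → A := TopologicalSpace.denseSeq A with hu
  let g : A → EuclideanSpace ℝ (Fin d) → ℝ := fun θ x => ∑ k, v k * θ.1.toNet.eval x k
  have hg := continuous_readout_eval (d := d) (L := L) v
  have hgm : ∀ θ, Measurable (g θ) := fun θ =>
    (hg.comp (by fun_prop : Continuous fun x => ((θ : NetWeights d H L), x))).measurable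
  have hgc : ∀ x, Continuous fun θ => g θ x := fun x =>
    hg.comp (by fun_prop : Continuous fun θ : A => ((θ : NetWeights d H L), x))
  let R : (Fin n → EuclideanSpace ℝ (Fin d) × Fin 2) → ℝ := fun S =>
    √(2 * basisPathMeasure γ d H L * (4 * (H : ℝ)) ^ (L - 1) * ‖v‖ ^ 2 *
      (⨆ i, ‖(S i).1‖ ^ 2) / n)
  set ε := 4 * √(2 * Real.log (4 / δ) / n) with hε
  have hε0 : 0 ≤ ε := by positivity
  -- The one-sided bound, to be applied to `ℓ` and to `-ℓ`.
  have main : ∀ ℓ' : ℝ → Fin 2 → ℝ, (∀ y, LipschitzWith 1 (fun t => ℓ' t y)) →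
      (∀ t y, |ℓ' t y| ≤ 1) → ∃ bad : Set (Fin n → EuclideanSpace ℝ (Fin d) × Fin 2),
        Measure.pi (fun _ : Fin n => P) bad ≤ ENNReal.ofReal (δ / 2) ∧ ∀ S ∉ bad, ∀ k,
          ∫ z, ℓ' (g (u k) z.1) z.2 ∂P - (n : ℝ)⁻¹ * ∑ i, ℓ' (g (u k) (S i).1) (S i).2 ≤
            ε + 2 * R S := by
    intro ℓ' hlip' hbdd'
    let h : ℕ → EuclideanSpace ℝ (Fin d) × Fin 2 → ℝ := fun k z => ℓ' (g (u k) z.1) z.2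
    have hb : ∀ k z, |h k z| ≤ 1 := fun k z => hbdd' _ _
    refine ⟨{S | ε ≤ uniformDeviation P h S - 2 * rademacherComplexity h S}, ?_, ?_⟩
    · rw [← ofReal_measureReal]
      exact ENNReal.ofReal_le_ofReal ((measureReal_le_uniformDeviation_sub_le P hn
        (fun k => measurable_loss hlip' (hgm _)) hb hε0).trans
          (exp_neg_threshold_le hn hδ hδ1.le))
    · intro S hS k
      have h1 : uniformDeviation P h S - 2 * rademacherComplexity h S < ε := not_le.1 hS
      have h2 : rademacherComplexity h S ≤ R S :=
        rademacherComplexity_loss_le hd hH hL hn v ℓ' hlip' (fun k => (u k).1.toNet)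
          (fun k => (u k).2) S
      have h3 : ∫ z, h k z ∂P - (n : ℝ)⁻¹ * ∑ i, h k (S i) ≤ uniformDeviation P h S :=
        le_ciSup (f := fun k => ∫ z, h k z ∂P - (n : ℝ)⁻¹ * ∑ i, h k (S i))
          (bddAbove_range_of_abs_le fun k => abs_deviation_le P (hb k) S) k
      change ∫ z, h k z ∂P - (n : ℝ)⁻¹ * ∑ i, h k (S i) ≤ _
      linarith
  obtain ⟨bad₁, hbad₁, h₁⟩ := main ℓ hlip hbdd
  obtain ⟨bad₂, hbad₂, h₂⟩ := main (fun t y => -ℓ t y) (fun y => (hlip y).neg)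
    (fun t y => by simpa using hbdd t y)
  have hsub : {S | ¬ genError (hypothesisSpace d H L γ v) ℓ P S ≤
      ENNReal.ofReal (ε + 2 * R S)} ⊆ bad₁ ∪ bad₂ := by
    intro S hS
    by_contra hcon
    rw [Set.mem_union, not_or] at hcon
    refine hS (iSup₂_le ?_)
    rintro _ ⟨w, hw, rfl⟩
    refine ENNReal.ofReal_le_ofReal ?_
    refine abs_deviation_le_of_denseRange hlip hbdd P hgm hgc
      (TopologicalSpace.denseRange_denseSeq A) S (fun k => ?_) ⟨(w.first, w.hidden), hw⟩
    have e₁ := h₁ S hcon.1 k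
    have e₂ := h₂ S hcon.2 k
    simp only [integral_neg, Finset.sum_neg_distrib] at e₂
    rw [one_div]
    exact abs_le.2 ⟨by linarith, by linarith⟩
  refine (measure_mono hsub).trans ((measure_union_le _ _).trans ?_)
  calc _ ≤ ENNReal.ofReal (δ / 2) + ENNReal.ofReal (δ / 2) := add_le_add hbad₁ hbad₂
    _ = ENNReal.ofReal δ := by
        rw [← ENNReal.ofReal_add (by positivity) (by positivity), add_halves]
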